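/- Let $d$ be the number of edges, $\ell_1,\dots,\ell_d>0$ the edge lengths, and $q_j\in W^{1,1}((0,\ell_j))$ real potentials. Let $U$ be a unitary $2d\times 2d$ matrix with $-1\notin\sigma(U)$, and let $H=-i(U+I)^{-1}(U-I)$. For $k\in\mathbb{C}$ let $c_j(\cdot,k)$ and $s_j(\cdot,k)$ be the solutions on $[0,\ell_j]$ of $$c_j(x,k)=\cos(kx)+\int_0^x\frac{\sin(k(x-t))}{k}\,q_j(t)\,c_j(t,k)\,dt,\qquad s_j(x,k)=\frac{\sin(kx)}{k}+\int_0^x\frac{\sin(k(x-t))}{k}\,q_j(t)\,s_j(t,k)\,dt,$$ where $\sin(kx)/k$ is read as $x$ at $k=0$. Let $M_1(k)$ and $M_2(k)$ be the block diagonal $2d\times 2d$ matrices with $j$-th diagonal blocks $$\begin{pmatrix}1&0\\ c_j(\ell_j,k)&s_j(\ell_j,k)\end{pmatrix}\qquad\text{and}\qquad\begin{pmatrix}0&1\\ -c_j'(\ell_j,k)&-s_j'(\ell_j,k)\end{pmatrix}$$ respectively (prime denotes the derivative in $x$), and define the secular function $\varphi(k)=\det[H M_1(k)+M_2(k)]$.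 For $N>0$ let $\Gamma_N$ be the square contour with vertices $\pm N\pm iN$. Then $\varphi$ is an entire function, and for every $\varepsilon>0$ there exists $K>0$ such that for all real $N>K$ with $$N\notin\bigcup_{i=1}^d\bigcup_{n\in\mathbb{N}_0}\left(\frac{n\pi}{\ell_i}-\frac{\varepsilon}{\ell_i},\ \frac{n\pi}{\ell_i}+\frac{\varepsilon}{\ell_i}\right)$$ the functions $\varphi(k)$ and $\prod_{i=1}^d(-k\sin(k\ell_i))$ have the same finite number of zeros, counted with multiplicity, inside $\Gamma_N$. -/

import Mathlib

open MeasureTheory Set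
open scoped ContDiff

noncomputable section

namespace QGraph

/-- `q ∈ W^{1,1}((0, ℓ))`: `q` is integrable on `(0, ℓ)` and has an integrable weak derivative. -/
def MemW11 (ℓ : ℝ) (q : ℝ → ℝ) : Prop :=
  IntegrableOn q (Ioo 0 ℓ) ∧
    ∃ g : ℝ → ℝ, IntegrableOn g (Ioo 0 ℓ) ∧
      ∀ η : ℝ → ℝ, ContDiff ℝ ∞ η → HasCompactSupport η → tsupport η ⊆ Ioo 0 ℓ →
        ∫ x in Ioo 0 ℓ, q x * deriv η x = - ∫ x in Ioo 0 ℓ, g x * η x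

/-- `sin (k x) / k`, with its limiting value `x` at `k = 0`. -/
def sinKernel (k : ℂ) (x : ℝ) : ℂ :=
  if k = 0 then (x : ℂ) else Complex.sin (k * x) / k

/-- The integral operator `f ↦ ∫₀ˣ (sin (k (x - t)) / k) q(t) f(t) dt`. -/
def volterraOp (q : ℝ → ℝ) (k : ℂ) (f : ℝ → ℂ) (x : ℝ) : ℂ :=
  ∫ t in (0 : ℝ)..x, sinKernel k (x - t) * (q t : ℂ) * f t

/-- The solution `y` of the Volterra equation `y = f + volterraOp q k y`, as the series obtained by
repeated substitution. `volterraSol_eq` and `volterraSol_unique` below show that it is the unique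
continuous solution. -/
def volterraSol (q : ℝ → ℝ) (k : ℂ) (f : ℝ → ℂ) (x : ℝ) : ℂ :=
  ∑' n : ℕ, ((volterraOp q k)^[n] f) x

lemma sinKernel_sub (k : ℂ) (x t : ℝ) :
    sinKernel k (x - t) =
      sinKernel k x * Complex.cos (k * t) - Complex.cos (k * x) * sinKernel k t := by
  unfold sinKernel
  split_ifs with h
  · simp [h]
  · push_cast
    rw [mul_sub, Complex.sin_sub]
    field_simp

lemma continuous_sinKernel (k : ℂ) : Continuous (sinKernel k) := by
  unfold sinKernel
  split_ifs with h
  · fun_prop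
  · fun_prop

lemma MemW11.intervalIntegrable {ℓ : ℝ} {q : ℝ → ℝ} (hℓ : 0 ≤ ℓ) (hq : MemW11 ℓ q) :
    IntervalIntegrable q volume 0 ℓ := by
  rw [intervalIntegrable_iff_integrableOn_Ioo_of_le hℓ]
  exact hq.1

section Volterra

variable {ℓ : ℝ} {q : ℝ → ℝ} {k : ℂ} {f : ℝ → ℂ}

lemma intervalIntegrable_mul (hq : IntervalIntegrable q volume 0 ℓ)
    {g : ℝ → ℂ} (hℓ : 0 ≤ ℓ) (hg : ContinuousOn g (Icc 0 ℓ)) :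
    IntervalIntegrable (fun t => (q t : ℂ) * g t) volume 0 ℓ := by
  have h : IntervalIntegrable (fun t => (q t : ℂ)) volume 0 ℓ :=
    ⟨hq.1.ofReal, hq.2.ofReal⟩
  exact h.mul_continuousOn (by rwa [uIcc_of_le hℓ])

lemma intervalIntegrable_sub {g : ℝ → ℂ} (hg : IntervalIntegrable g volume 0 ℓ)
    {x : ℝ} (hx : x ∈ Icc 0 ℓ) : IntervalIntegrable g volume 0 x := by
  refine hg.mono_set ?_
  rw [uIcc_of_le hx.1, uIcc_of_le (hx.1.trans hx.2)]
  exact Icc_subset_Icc_right hx.2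

lemma volterraOp_expand (hq : IntervalIntegrable q volume 0 ℓ) (hf : ContinuousOn f (Icc 0 ℓ))
    {x : ℝ} (hx : x ∈ Icc 0 ℓ) :
    volterraOp q k f x =
      sinKernel k x * (∫ t in (0 : ℝ)..x, (q t : ℂ) * (Complex.cos (k * t) * f t)) -
      Complex.cos (k * x) * (∫ t in (0 : ℝ)..x, (q t : ℂ) * (sinKernel k t * f t)) := by
  have hℓ : 0 ≤ ℓ := hx.1.trans hx.2
  have hs := continuous_sinKernel k
  have h1 : IntervalIntegrable (fun t => (q t : ℂ) * (Complex.cos (k * t) * f t)) volume 0 x :=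
    intervalIntegrable_sub (intervalIntegrable_mul hq hℓ
      ((by fun_prop : Continuous fun t : ℝ => Complex.cos (k * t)).continuousOn.mul hf)) hx
  have h2 : IntervalIntegrable (fun t => (q t : ℂ) * (sinKernel k t * f t)) volume 0 x :=
    intervalIntegrable_sub (intervalIntegrable_mul hq hℓ (hs.continuousOn.mul hf)) hx
  rw [← intervalIntegral.integral_const_mul, ← intervalIntegral.integral_const_mul,
    ← intervalIntegral.integral_sub (h1.const_mul _) (h2.const_mul _)]
  unfold volterraOp
  congr 1
  ext t
  rw [sinKernel_sub]
  ring

lemma continuousOn_volterraOp (hq : IntervalIntegrable q volume 0 ℓ)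
    (hf : ContinuousOn f (Icc 0 ℓ)) : ContinuousOn (volterraOp q k f) (Icc 0 ℓ) := by
  rcases le_or_gt 0 ℓ with hℓ | hℓ
  swap
  · simp [Icc_eq_empty (not_le.2 hℓ)]
  have hs := continuous_sinKernel k
  have key : ∀ g : ℝ → ℂ, ContinuousOn g (Icc 0 ℓ) →
      ContinuousOn (fun x => ∫ t in (0 : ℝ)..x, (q t : ℂ) * g t) (Icc 0 ℓ) := by
    intro g hg
    have h := intervalIntegral.continuousOn_primitive_interval'
      (intervalIntegrable_mul hq hℓ hg) left_mem_uIcc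
    rwa [uIcc_of_le hℓ] at h
  have hc : Continuous fun t : ℝ => Complex.cos (k * t) := by fun_prop
  refine ContinuousOn.congr ?_ (fun x hx => volterraOp_expand hq hf hx)
  exact (hs.continuousOn.mul (key _ (hc.continuousOn.mul hf))).sub
    (hc.continuousOn.mul (key _ (hs.continuousOn.mul hf)))

lemma continuousOn_iterate (hq : IntervalIntegrable q volume 0 ℓ)
    (hf : ContinuousOn f (Icc 0 ℓ)) (n : ℕ) :
    ContinuousOn ((volterraOp q k)^[n] f) (Icc 0 ℓ) := by
  induction n with
  | zero => simpa using hf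
  | succ n ih =>
    rw [Function.iterate_succ_apply']
    exact continuousOn_volterraOp hq ih

lemma integral_abs_mul_pow (hq : IntervalIntegrable q volume 0 ℓ) {x : ℝ} (hx : x ∈ Icc 0 ℓ)
    (n : ℕ) :
    ∫ t in (0 : ℝ)..x, |q t| * (∫ s in (0 : ℝ)..t, |q s|) ^ n =
      (∫ s in (0 : ℝ)..x, |q s|) ^ (n + 1) / (n + 1) := by
  have hqx : IntervalIntegrable (fun t => |q t|) volume 0 x := by
    refine (hq.mono_set ?_).abs
    rw [uIcc_of_le hx.1, uIcc_of_le (hx.1.trans hx.2)]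
    exact Icc_subset_Icc_right hx.2
  set Q : ℝ → ℝ := fun t => ∫ s in (0 : ℝ)..t, |q s| with hQ
  have hac : AbsolutelyContinuousOnInterval Q 0 x :=
    hqx.absolutelyContinuousOnInterval_intervalIntegral left_mem_uIcc
  have hpow : ∀ m : ℕ, AbsolutelyContinuousOnInterval (fun t => Q t ^ (m + 1)) 0 x := by
    intro m
    induction m with
    | zero => simpa using hac
    | succ m ih =>
      have := ih.mul hac
      have e : (fun t => Q t ^ (m + 1 + 1)) = (fun t => Q t ^ (m + 1)) * Q := by
        ext t
        simp [pow_succ]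
      rwa [e]
  have h0 := (hpow n).integral_deriv_eq_sub
  have hae : ∀ᵐ t, t ∈ uIoc 0 x → HasDerivAt Q (|q t|) t := by
    have h := hqx.ae_hasDerivAt_integral
    filter_upwards [h] with t ht htm
    exact ht (uIoc_subset_uIcc htm) 0 left_mem_uIcc
  have h1 : ∫ t in (0 : ℝ)..x, deriv (fun t => Q t ^ (n + 1)) t =
      ∫ t in (0 : ℝ)..x, ((n : ℝ) + 1) * (|q t| * Q t ^ n) := by
    refine intervalIntegral.integral_congr_ae ?_
    filter_upwards [hae] with t ht htm
    have := ((ht htm).pow (n + 1)).deriv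
    have e : (Q ^ (n + 1)) = fun t => Q t ^ (n + 1) := by ext; simp
    rw [e] at this
    rw [this]
    push_cast
    ring_nf
  rw [h1, intervalIntegral.integral_const_mul] at h0
  have hQ0 : Q 0 = 0 := by simp [hQ]
  rw [hQ0] at h0
  have hn : ((n : ℝ) + 1) ≠ 0 := by positivity
  rw [eq_div_iff hn, mul_comm, h0]
  simp [hQ]

lemma iterate_bound (hq : IntervalIntegrable q volume 0 ℓ)
    {M F : ℝ} (hM : ∀ x ∈ Icc 0 ℓ, ‖sinKernel k x‖ ≤ M) (hF : ∀ x ∈ Icc 0 ℓ, ‖f x‖ ≤ F)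
    (n : ℕ) : ∀ x ∈ Icc 0 ℓ, ‖((volterraOp q k)^[n] f) x‖ ≤
      F * (M * ∫ t in (0 : ℝ)..x, |q t|) ^ n / n.factorial := by
  induction n with
  | zero => simpa using hF
  | succ n ih =>
    intro x hx
    have hℓ : 0 ≤ ℓ := hx.1.trans hx.2
    have hM0 : 0 ≤ M := (norm_nonneg _).trans (hM x hx)
    rw [Function.iterate_succ_apply']
    have hsub : uIcc 0 x ⊆ uIcc 0 ℓ := by
      rw [uIcc_of_le hx.1, uIcc_of_le hℓ]
      exact Icc_subset_Icc_right hx.2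
    have hqx : IntervalIntegrable (fun t => |q t|) volume 0 x := (hq.mono_set hsub).abs
    have hQc : ContinuousOn (fun t => ∫ s in (0 : ℝ)..t, |q s|) (uIcc 0 x) :=
      intervalIntegral.continuousOn_primitive_interval' hqx left_mem_uIcc
    have hint : IntervalIntegrable
        (fun t => (F * M ^ (n + 1) / n.factorial) *
          (|q t| * (∫ s in (0 : ℝ)..t, |q s|) ^ n)) volume 0 x :=
      (hqx.mul_continuousOn (hQc.pow n)).const_mul _
    have hle := intervalIntegral.norm_integral_le_of_norm_le (μ := volume) hx.1
      (f := fun t => sinKernel k (x - t) * (q t : ℂ) * ((volterraOp q k)^[n] f) t)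
      (Filter.Eventually.of_forall (fun t ht => ?_)) hint
    · refine hle.trans (le_of_eq ?_)
      rw [intervalIntegral.integral_const_mul, integral_abs_mul_pow hq hx, Nat.factorial_succ]
      push_cast
      have : (n.factorial : ℝ) ≠ 0 := by positivity
      field_simp
      ring
    · have ht' : t ∈ Icc 0 ℓ := ⟨ht.1.le, ht.2.trans hx.2⟩
      have h1 : ‖sinKernel k (x - t)‖ ≤ M :=
        hM _ ⟨by linarith [ht.2], by linarith [ht.1, hx.2]⟩
      rw [norm_mul, norm_mul, Complex.norm_real, Real.norm_eq_abs]
      calc _ ≤ M * |q t| * (F * (M * ∫ s in (0 : ℝ)..t, |q s|) ^ n / n.factorial) := by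
            gcongr
            exact ih t ht'
        _ = _ := by ring

lemma exists_bounds (k : ℂ) (hf : ContinuousOn f (Icc 0 ℓ)) :
    ∃ M F : ℝ, 0 ≤ M ∧ 0 ≤ F ∧ (∀ x ∈ Icc 0 ℓ, ‖sinKernel k x‖ ≤ M) ∧
      (∀ x ∈ Icc 0 ℓ, ‖f x‖ ≤ F) := by
  obtain ⟨M, hM⟩ := isCompact_Icc.exists_bound_of_continuousOn
    (continuous_sinKernel k).continuousOn (s := Icc 0 ℓ)
  obtain ⟨F, hF⟩ := isCompact_Icc.exists_bound_of_continuousOn hf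
  exact ⟨max M 0, max F 0, le_max_right _ _, le_max_right _ _,
    fun x hx => (hM x hx).trans (le_max_left _ _), fun x hx => (hF x hx).trans (le_max_left _ _)⟩

lemma exists_iterate_bound (k : ℂ) (hq : IntervalIntegrable q volume 0 ℓ)
    (hf : ContinuousOn f (Icc 0 ℓ)) :
    ∃ u : ℕ → ℝ, Summable u ∧ ∀ n, ∀ x ∈ Icc 0 ℓ, ‖((volterraOp q k)^[n] f) x‖ ≤ u n := by
  obtain ⟨M, F, hM0, hF0, hM, hF⟩ := exists_bounds k hf
  refine ⟨fun n => F * ((M * ∫ t in (0 : ℝ)..ℓ, |q t|) ^ n / n.factorial),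
    (Real.summable_pow_div_factorial _).mul_left _, fun n x hx => ?_⟩
  refine (iterate_bound hq hM hF n x hx).trans ?_
  rw [mul_div_assoc]
  have h0 : 0 ≤ ∫ t in (0 : ℝ)..x, |q t| :=
    intervalIntegral.integral_nonneg hx.1 (fun t _ => abs_nonneg _)
  have h1 : ∫ t in (0 : ℝ)..x, |q t| ≤ ∫ t in (0 : ℝ)..ℓ, |q t| :=
    intervalIntegral.integral_mono_interval le_rfl hx.1 hx.2
      (Filter.Eventually.of_forall fun t => abs_nonneg _) hq.abs
  dsimp only
  gcongr

lemma continuousOn_volterraSol (hq : IntervalIntegrable q volume 0 ℓ)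
    (hf : ContinuousOn f (Icc 0 ℓ)) : ContinuousOn (volterraSol q k f) (Icc 0 ℓ) := by
  obtain ⟨u, hu, hb⟩ := exists_iterate_bound k hq hf
  exact continuousOn_tsum (fun n => continuousOn_iterate hq hf n) hu hb

/-- The series solves the Volterra equation. -/
theorem volterraSol_eq (hq : IntervalIntegrable q volume 0 ℓ) (hf : ContinuousOn f (Icc 0 ℓ))
    {x : ℝ} (hx : x ∈ Icc 0 ℓ) :
    volterraSol q k f x = f x +
      ∫ t in (0 : ℝ)..x, sinKernel k (x - t) * (q t : ℂ) * volterraSol q k f t := by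
  have hℓ : 0 ≤ ℓ := hx.1.trans hx.2
  obtain ⟨u, hu, hb⟩ := exists_iterate_bound k hq hf
  obtain ⟨M, F, hM0, hF0, hM, hF⟩ := exists_bounds k hf
  have hsum : ∀ t ∈ Icc 0 ℓ, Summable fun n => ((volterraOp q k)^[n] f) t := fun t ht =>
    Summable.of_norm_bounded hu (fun n => hb n t ht)
  have hqx : IntervalIntegrable q volume 0 x := by
    refine hq.mono_set ?_
    rw [uIcc_of_le hx.1, uIcc_of_le hℓ]
    exact Icc_subset_Icc_right hx.2
  have hs := continuous_sinKernel k
  have key : HasSum (fun n => volterraOp q k ((volterraOp q k)^[n] f) x)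
      (∫ t in (0 : ℝ)..x, sinKernel k (x - t) * (q t : ℂ) * volterraSol q k f t) := by
    refine intervalIntegral.hasSum_integral_of_dominated_convergence
      (fun n t => (M * |q t|) * u n) (fun n => ?_) (fun n => ?_) ?_ ?_ ?_
    · have h := intervalIntegrable_sub (intervalIntegrable_mul hq hℓ
        ((by fun_prop : Continuous fun t : ℝ => sinKernel k (x - t)).continuousOn.mul
          (continuousOn_iterate (k := k) hq hf n))) hx
      refine (intervalIntegrable_iff.1 h).aestronglyMeasurable.congr (Filter.Eventually.of_forall fun t => ?_)
      simp only [Pi.mul_apply]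
      ring
    · refine Filter.Eventually.of_forall fun t ht => ?_
      rw [uIoc_of_le hx.1] at ht
      have h1 : ‖sinKernel k (x - t)‖ ≤ M :=
        hM _ ⟨by linarith [ht.2], by linarith [ht.1, hx.2]⟩
      rw [norm_mul, norm_mul, Complex.norm_real, Real.norm_eq_abs]
      gcongr
      exact hb n t ⟨ht.1.le, ht.2.trans hx.2⟩
    · exact Filter.Eventually.of_forall fun t _ => hu.mul_left _
    · simp_rw [tsum_mul_left]
      exact (hqx.abs.const_mul M).mul_const _
    · refine Filter.Eventually.of_forall fun t ht => ?_
      rw [uIoc_of_le hx.1] at ht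
      exact ((hsum t ⟨ht.1.le, ht.2.trans hx.2⟩).hasSum).mul_left _
  rw [volterraSol, (hsum x hx).tsum_eq_zero_add, ← key.tsum_eq]
  simp only [Function.iterate_succ_apply', Function.iterate_zero, id]

/-- The continuous solution of the Volterra equation is unique. -/
theorem volterraSol_unique (hq : IntervalIntegrable q volume 0 ℓ)
    (hf : ContinuousOn f (Icc 0 ℓ)) {y : ℝ → ℂ} (hy : ContinuousOn y (Icc 0 ℓ))
    (hye : ∀ x ∈ Icc 0 ℓ, y x = f x +
      ∫ t in (0 : ℝ)..x, sinKernel k (x - t) * (q t : ℂ) * y t) :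
    EqOn y (volterraSol q k f) (Icc 0 ℓ) := by
  have hv := continuousOn_volterraSol (k := k) hq hf
  set w : ℝ → ℂ := fun x => y x - volterraSol q k f x with hw
  have hwc : ContinuousOn w (Icc 0 ℓ) := hy.sub hv
  have hint : ∀ g : ℝ → ℂ, ContinuousOn g (Icc 0 ℓ) → ∀ x ∈ Icc 0 ℓ,
      IntervalIntegrable (fun t => sinKernel k (x - t) * (q t : ℂ) * g t) volume 0 x := by
    intro g hg x hx
    have hs := continuous_sinKernel k
    have h := intervalIntegrable_sub (intervalIntegrable_mul hq (hx.1.trans hx.2)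
      ((by fun_prop : Continuous fun t : ℝ => sinKernel k (x - t)).continuousOn.mul hg)) hx
    refine h.congr (fun t _ => ?_)
    simp only [Pi.mul_apply]
    ring
  have hfix : ∀ x ∈ Icc 0 ℓ, w x = volterraOp q k w x := by
    intro x hx
    simp only [hw, volterraOp, mul_sub]
    rw [intervalIntegral.integral_sub (hint y hy x hx) (hint _ hv x hx), hye x hx,
      volterraSol_eq hq hf hx]
    ring
  have hiter : ∀ n, ∀ x ∈ Icc 0 ℓ, ((volterraOp q k)^[n] w) x = w x := by
    intro n
    induction n with
    | zero => simp
    | succ n ih =>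
      intro x hx
      rw [Function.iterate_succ_apply', hfix x hx]
      unfold volterraOp
      refine intervalIntegral.integral_congr fun t ht => ?_
      rw [uIcc_of_le hx.1] at ht
      have := ih t ⟨ht.1, ht.2.trans hx.2⟩
      unfold volterraOp at this
      simp only [this]
  obtain ⟨u, hu, hb⟩ := exists_iterate_bound k hq hwc
  intro x hx
  have hle : ∀ n, ‖w x‖ ≤ u n := fun n => by rw [← hiter n x hx]; exact hb n x hx
  have h0 : ‖w x‖ ≤ 0 := ge_of_tendsto' hu.tendsto_atTop_zero hle
  exact sub_eq_zero.1 (norm_le_zero_iff.1 h0)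

end Volterra

/-- The solution `c(x, k)` of `-y'' + q y = k² y` with `c(0) = 1`, `c'(0) = 0`. -/
def cosSol (q : ℝ → ℝ) (k : ℂ) : ℝ → ℂ :=
  volterraSol q k (fun x => Complex.cos (k * x))

/-- The solution `s(x, k)` of `-y'' + q y = k² y` with `s(0) = 0`, `s'(0) = 1`. -/
def sinSol (q : ℝ → ℝ) (k : ℂ) : ℝ → ℂ :=
  volterraSol q k (sinKernel k)

theorem cosSol_eq {ℓ : ℝ} {q : ℝ → ℝ} (hq : MemW11 ℓ q) (k : ℂ) {x : ℝ} (hx : x ∈ Icc 0 ℓ) :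
    cosSol q k x = Complex.cos (k * x) +
      ∫ t in (0 : ℝ)..x, sinKernel k (x - t) * (q t : ℂ) * cosSol q k t :=
  volterraSol_eq (hq.intervalIntegrable (hx.1.trans hx.2))
    (by fun_prop : Continuous fun x : ℝ => Complex.cos (k * x)).continuousOn hx

theorem sinSol_eq {ℓ : ℝ} {q : ℝ → ℝ} (hq : MemW11 ℓ q) (k : ℂ) {x : ℝ} (hx : x ∈ Icc 0 ℓ) :
    sinSol q k x = sinKernel k x +
      ∫ t in (0 : ℝ)..x, sinKernel k (x - t) * (q t : ℂ) * sinSol q k t :=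
  volterraSol_eq (hq.intervalIntegrable (hx.1.trans hx.2))
    (continuous_sinKernel k).continuousOn hx

/-- The Hermitian matrix `H = -i (U + I)⁻¹ (U - I)`. The index `(j, 0)` is the beginning of
edge `j` and `(j, 1)` is its end. -/
def couplingH {d : ℕ} (U : Matrix (Fin d × Fin 2) (Fin d × Fin 2) ℂ) :
    Matrix (Fin d × Fin 2) (Fin d × Fin 2) ℂ :=
  (-Complex.I) • ((U + 1)⁻¹ * (U - 1))

/-- The matrix of boundary values. The column `(j, 0)` belongs to `c_j`, the column `(j, 1)`
to `s_j`. -/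
def M₁ {d : ℕ} (ℓ : Fin d → ℝ) (q : Fin d → ℝ → ℝ) (k : ℂ) :
    Matrix (Fin d × Fin 2) (Fin d × Fin 2) ℂ :=
  Matrix.of fun p r => if p.1 = r.1 then
    !![1, 0;
       cosSol (q p.1) k (ℓ p.1), sinSol (q p.1) k (ℓ p.1)] p.2 r.2 else 0

/-- The matrix of outgoing boundary derivatives (derivatives on the edge `[0, ℓ_j]`, one-sided at
its end points). -/
def M₂ {d : ℕ} (ℓ : Fin d → ℝ) (q : Fin d → ℝ → ℝ) (k : ℂ) :
    Matrix (Fin d × Fin 2) (Fin d × Fin 2) ℂ :=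
  Matrix.of fun p r => if p.1 = r.1 then
    !![0, 1;
       -derivWithin (cosSol (q p.1) k) (Icc 0 (ℓ p.1)) (ℓ p.1),
       -derivWithin (sinSol (q p.1) k) (Icc 0 (ℓ p.1)) (ℓ p.1)] p.2 r.2 else 0

/-- The secular function `φ(k) = det (H M₁(k) + M₂(k))`. -/
def secular {d : ℕ} (ℓ : Fin d → ℝ) (q : Fin d → ℝ → ℝ)
    (U : Matrix (Fin d × Fin 2) (Fin d × Fin 2) ℂ) (k : ℂ) : ℂ :=
  (couplingH U * M₁ ℓ q k + M₂ ℓ q k).det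

/-- The leading term `∏ᵢ (-k sin (k ℓᵢ))`. -/
def sineProduct {d : ℕ} (ℓ : Fin d → ℝ) (k : ℂ) : ℂ :=
  ∏ i, (-k * Complex.sin (k * ℓ i))

/-- The region inside the square contour with vertices `±N ± iN`. -/
def insideSquare (N : ℝ) : Set ℂ :=
  {z | |z.re| < N ∧ |z.im| < N}

/-- The zeros of `f` in `V`. -/
def zerosIn (f : ℂ → ℂ) (V : Set ℂ) : Set ℂ :=
  {z | z ∈ V ∧ f z = 0}

/-- The number of zeros in `V`, counted with multiplicity, of a function `f` that is holomorphic
near `V` and has finitely many zeros there. -/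
def zeroCount (f : ℂ → ℂ) (V : Set ℂ) : ℕ :=
  ∑ᶠ z ∈ zerosIn f V, analyticOrderNatAt f z

end QGraph

end

/-!
By variation of parameters, a solution is a combination of `cos (k x)` and `sin (k x) / k` whose
coefficients are its moments. A determinant in these moments has derivative zero, hence the
Wronskian of `c_j` and `s_j` is `1`, which makes `M₁ M₂⁻¹` explicit in
`φ = det (H M₁ M₂⁻¹ + 1) ∏ⱼ c_j'(ℓ_j)`. Away from the points `n π / ℓ_j`,
`‖sin (k ℓ_j)‖` is at least a constant times `exp (|Im k| ℓ_j)` on the contour. Hence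
`M₁ M₂⁻¹ → 0` and `c_j'(ℓ_j) ~ -k sin (k ℓ_j)` there, so `φ` is asymptotic to the product of sines
and Rouché's theorem applies.
-/

noncomputable section

namespace QGraph

section Contour

open Complex (I slitPlane)

/-- The boundary of the square with vertices `±N ± iN`. -/
def squareContour (N : ℝ) : Set ℂ :=
  {z | max |z.re| |z.im| = N}

/-- The closed square with vertices `±N ± iN`. -/
def closedSquare (N : ℝ) : Set ℂ :=
  Icc (-N) N ×ℂ Icc (-N) N

/-- The `k`-th side of the square with vertices `±N ± iN`, traversed as `t` increases from `-N` to
`N`: side `0` is the right one, and multiplication by `i` turns each side into the next one. -/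
def squareSide (N : ℝ) (k : ℕ) (t : ℝ) : ℂ :=
  I ^ k * (N + t * I)

/-- The integral over the positively oriented boundary of the square with vertices `±N ± iN`. -/
def squareIntegral (N : ℝ) (f : ℂ → ℂ) : ℂ :=
  ∑ k ∈ Finset.range 4, ∫ t in -N..N, I ^ (k + 1) * f (squareSide N k t)

variable {N : ℝ} {f g : ℂ → ℂ} {w z : ℂ}

lemma insideSquare_union_squareContour : insideSquare N ∪ squareContour N = closedSquare N := by
  ext z
  simp only [insideSquare, squareContour, closedSquare, mem_union, mem_ofPred_eq, ← max_lt_iff,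
    ← le_iff_lt_or_eq, Complex.mem_reProdIm, mem_Icc, ← abs_le, max_le_iff]

lemma insideSquare_subset_closedSquare : insideSquare N ⊆ closedSquare N :=
  insideSquare_union_squareContour ▸ subset_union_left

lemma squareContour_subset_closedSquare : squareContour N ⊆ closedSquare N :=
  insideSquare_union_squareContour ▸ subset_union_right

lemma isCompact_closedSquare : IsCompact (closedSquare N) :=
  isCompact_Icc.reProdIm isCompact_Icc

lemma isPreconnected_closedSquare : IsPreconnected (closedSquare N) :=
  (((convex_Icc _ _).linear_preimage Complex.reLm).inter
    ((convex_Icc _ _).linear_preimage Complex.imLm)).isPreconnected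

lemma ofReal_mem_squareContour (hN : 0 ≤ N) : (N : ℂ) ∈ squareContour N := by
  simp [squareContour, abs_of_nonneg hN, hN]

lemma ne_zero_of_mem_squareContour (hN : 0 < N) (hz : z ∈ squareContour N) : z ≠ 0 := by
  rintro rfl
  simp [squareContour, hN.ne] at hz

lemma ne_of_mem_squareContour_of_mem_insideSquare (hz : z ∈ squareContour N)
    (hw : w ∈ insideSquare N) : z ≠ w := by
  rintro rfl
  exact (max_lt hw.1 hw.2).ne hz

lemma I_mul_mem_squareContour (hz : z ∈ squareContour N) : I * z ∈ squareContour N := by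
  simpa [squareContour, max_comm] using hz

lemma squareSide_mem_squareContour {t : ℝ} (ht : t ∈ Icc (-N) N) (k : ℕ) :
    squareSide N k t ∈ squareContour N := by
  induction k with
  | zero =>
    have hN : |N| = N := abs_of_nonneg (by linarith [ht.1, ht.2])
    simpa [squareSide, squareContour, hN] using abs_le.2 ht
  | succ k ih => simpa [squareSide, pow_succ', mul_assoc] using I_mul_mem_squareContour ih

lemma hasDerivAt_squareSide (N : ℝ) (k : ℕ) (t : ℝ) :
    HasDerivAt (squareSide N k) (I ^ (k + 1)) t := by
  have h : HasDerivAt (fun t : ℝ => (N + t * I : ℂ)) I t := by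
    simpa using (Complex.ofRealCLM.hasDerivAt.mul_const I).const_add (N : ℂ)
  rw [pow_succ]
  exact h.const_mul (I ^ k)

lemma squareSide_succ_neg (N : ℝ) (k : ℕ) :
    squareSide N (k + 1) (-N) = squareSide N k N := by
  simp only [squareSide, pow_succ, Complex.ofReal_neg]
  linear_combination -I ^ k * N * Complex.I_mul_I

lemma intervalIntegrable_squareSide (hN : 0 ≤ N) (hf : ContinuousOn f (squareContour N)) (k : ℕ) :
    IntervalIntegrable (fun t => I ^ (k + 1) * f (squareSide N k t)) volume (-N) N := by
  refine ContinuousOn.intervalIntegrable (.mul continuousOn_const (hf.comp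
    (fun t _ => (hasDerivAt_squareSide N k t).continuousAt.continuousWithinAt) fun t ht => ?_))
  rw [uIcc_of_le (by linarith)] at ht
  exact squareSide_mem_squareContour ht k

lemma squareIntegral_congr (hN : 0 ≤ N) (h : EqOn f g (squareContour N)) :
    squareIntegral N f = squareIntegral N g := by
  refine Finset.sum_congr rfl fun k _ => intervalIntegral.integral_congr fun t ht => ?_
  rw [uIcc_of_le (by linarith)] at ht
  simp only [h (squareSide_mem_squareContour ht k)]

lemma squareIntegral_add (hN : 0 ≤ N) (hf : ContinuousOn f (squareContour N))
    (hg : ContinuousOn g (squareContour N)) :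
    squareIntegral N (fun z => f z + g z) = squareIntegral N f + squareIntegral N g := by
  simp only [squareIntegral, mul_add, ← Finset.sum_add_distrib]
  exact Finset.sum_congr rfl fun k _ => intervalIntegral.integral_add
    (intervalIntegrable_squareSide hN hf k) (intervalIntegrable_squareSide hN hg k)

lemma squareIntegral_eq_zero_of_hasDerivAt (hN : 0 ≤ N) (hf : ContinuousOn f (squareContour N))
    (h : ∀ z ∈ squareContour N, HasDerivAt g (f z) z) : squareIntegral N f = 0 := by
  have hside (k : ℕ) : ∫ t in -N..N, I ^ (k + 1) * f (squareSide N k t) =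
      g (squareSide N (k + 1) (-N)) - g (squareSide N k (-N)) := by
    rw [squareSide_succ_neg]
    refine intervalIntegral.integral_eq_sub_of_hasDerivAt (f := g ∘ squareSide N k)
      (fun t ht => ?_) (intervalIntegrable_squareSide hN hf k)
    rw [uIcc_of_le (by linarith)] at ht
    rw [mul_comm]
    exact (h _ (squareSide_mem_squareContour ht k)).comp t (hasDerivAt_squareSide N k t)
  simp only [squareIntegral, hside, Finset.sum_range_sub fun k => g (squareSide N k (-N))]
  simp [squareSide]

lemma squareIntegral_eq_zero_of_differentiableOn (hN : 0 ≤ N)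
    (hf : DifferentiableOn ℂ f (closedSquare N)) : squareIntegral N f = 0 := by
  have hrect := Complex.integral_boundary_rect_eq_zero_of_differentiableOn f
    (-N + (-N : ℝ) * I) (N + N * I)
    (by simpa [closedSquare, uIcc_of_le (show -N ≤ N by linarith)] using hf)
  have hside₀ (t : ℝ) : squareSide N 0 t = N + t * I := by simp [squareSide]
  have hside₁ (t : ℝ) : squareSide N 1 t = (-t : ℝ) + N * I := by
    push_cast [squareSide]
    linear_combination (t : ℂ) * Complex.I_sq
  have hside₂ (t : ℝ) : squareSide N 2 t = -N + (-t : ℝ) * I := by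
    push_cast [squareSide]
    linear_combination (N + t * I) * Complex.I_sq
  have hside₃ (t : ℝ) : squareSide N 3 t = t + (-N : ℝ) * I := by
    push_cast [squareSide]
    linear_combination (N * I + t * (I ^ 2 - 1)) * Complex.I_sq
  have hneg (φ : ℝ → ℂ) : ∫ t in -N..N, φ (-t) = ∫ t in -N..N, φ t := by
    rw [intervalIntegral.integral_comp_neg, neg_neg]
  simp only [squareIntegral, intervalIntegral.integral_const_mul, Finset.sum_range_succ,
    Finset.sum_range_zero, hside₀, hside₁, hside₂, hside₃, hneg fun t => f (t + N * I),
    hneg fun t => f (-N + t * I)]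
  simp only [Complex.ofReal_neg, neg_mul, Complex.add_im, Complex.neg_im, Complex.ofReal_im,
    neg_zero, Complex.mul_im, Complex.ofReal_re, Complex.I_im, mul_one, Complex.I_re, mul_zero,
    add_zero, zero_add, Complex.add_re, Complex.neg_re, Complex.mul_re, sub_self,
    smul_eq_mul] at hrect
  simp only [zero_add, pow_one, Nat.reduceAdd, Complex.I_sq, neg_mul, one_mul,
    Complex.I_pow_three, Complex.I_pow_four, Complex.ofReal_neg]
  linear_combination hrect

lemma squareIntegral_inv (hN : 0 < N) :
    squareIntegral N (fun z => z⁻¹) = 2 * Real.pi * I := by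
  have hre (t : ℝ) : 0 < (squareSide N 0 t).re := by simpa [squareSide] using hN
  have hne (t : ℝ) : squareSide N 0 t ≠ 0 := fun h => by simpa [h] using hre t
  have hlog (t : ℝ) : HasDerivAt (fun t => Complex.log (squareSide N 0 t))
      (I * (squareSide N 0 t)⁻¹) t := by
    simpa [div_eq_mul_inv] using (hasDerivAt_squareSide N 0 t).clog_real (.inl (hre t))
  have hright : ∫ t in -N..N, I * (squareSide N 0 t)⁻¹ = Real.pi / 2 * I := by
    have hint : IntervalIntegrable (fun t => I * (squareSide N 0 t)⁻¹) volume (-N) N := by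
      simpa using intervalIntegrable_squareSide hN.le
        (continuousOn_inv₀.mono fun z hz => ne_zero_of_mem_squareContour hN hz) 0
    have hcorner : squareSide N 0 N = I * squareSide N 0 (-N) := by
      rw [← squareSide_succ_neg]
      simp [squareSide]
    have harg := abs_lt.1 (Complex.abs_arg_lt_pi_div_two_iff.2 (.inl (hre (-N))))
    rw [intervalIntegral.integral_eq_sub_of_hasDerivAt (fun t _ => hlog t) hint, hcorner,
      Complex.log_mul Complex.I_ne_zero (hne _), Complex.log_I, add_sub_cancel_right]
    rw [Complex.arg_I]
    exact ⟨by linarith, by linarith⟩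
  have hside (k : ℕ) : ∫ t in -N..N, I ^ (k + 1) * (squareSide N k t)⁻¹ = Real.pi / 2 * I := by
    rw [← hright]
    refine intervalIntegral.integral_congr fun t _ => ?_
    simp only [squareSide]
    field_simp
    ring
  simp only [squareIntegral, hside, Finset.sum_const, Finset.card_range, nsmul_eq_mul]
  push_cast
  ring

lemma continuousOn_logDeriv {s : Set ℂ} (hf : AnalyticOnNhd ℂ f s) (h0 : ∀ z ∈ s, f z ≠ 0) :
    ContinuousOn (logDeriv f) s :=
  hf.deriv.continuousOn.div hf.continuousOn h0

lemma squareIntegral_logDeriv_of_mem_slitPlane (hN : 0 ≤ N)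
    (hf : AnalyticOnNhd ℂ f (squareContour N)) (h : ∀ z ∈ squareContour N, f z ∈ slitPlane) :
    squareIntegral N (logDeriv f) = 0 :=
  squareIntegral_eq_zero_of_hasDerivAt hN
    (continuousOn_logDeriv hf fun z hz => Complex.slitPlane_ne_zero (h z hz))
    (fun z hz => (hf z hz).differentiableAt.hasDerivAt.clog (h z hz))

/-- The quotient `f / g` has a logarithm along the contour. -/
lemma squareIntegral_logDeriv_eq_of_div_mem_slitPlane (hN : 0 ≤ N)
    (hf : AnalyticOnNhd ℂ f (squareContour N)) (hg : AnalyticOnNhd ℂ g (squareContour N))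
    (h : ∀ z ∈ squareContour N, f z / g z ∈ slitPlane) :
    squareIntegral N (logDeriv f) = squareIntegral N (logDeriv g) := by
  have hne (z) (hz : z ∈ squareContour N) := div_ne_zero_iff.1 (Complex.slitPlane_ne_zero (h z hz))
  have hfg : AnalyticOnNhd ℂ (fun z => f z / g z) (squareContour N) :=
    fun z hz => (hf z hz).div (hg z hz) (hne z hz).2
  have hlog : EqOn (logDeriv f) (fun z => logDeriv (fun z => f z / g z) z + logDeriv g z)
      (squareContour N) := fun z hz => by
    simp only [logDeriv_div z (hne z hz).1 (hne z hz).2 (hf z hz).differentiableAt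
      (hg z hz).differentiableAt, sub_add_cancel]
  rw [squareIntegral_congr hN hlog, squareIntegral_add hN
    (continuousOn_logDeriv hfg fun z hz => Complex.slitPlane_ne_zero (h z hz))
    (continuousOn_logDeriv hg fun z hz => (hne z hz).2),
    squareIntegral_logDeriv_of_mem_slitPlane hN hfg h, zero_add]

lemma sub_div_mem_slitPlane (hz : z ∈ squareContour N) (hw : w ∈ insideSquare N) :
    (z - w) / z ∈ slitPlane := by
  have hz0 : z ≠ 0 := ne_zero_of_mem_squareContour ((abs_nonneg _).trans_lt hw.1) hz
  by_contra hslit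
  simp only [Complex.mem_slitPlane_iff, not_or, not_lt, not_not] at hslit
  obtain ⟨r, hr, hrz⟩ : ∃ r : ℝ, 1 ≤ r ∧ w = r * z := by
    refine ⟨1 - ((z - w) / z).re, by linarith [hslit.1], ?_⟩
    have hreal : (((z - w) / z).re : ℂ) = (z - w) / z := Complex.ext (by simp) (by simp [hslit.2])
    rw [Complex.ofReal_sub, hreal]
    field_simp
    simp
  have hscale (x : ℝ) : |x| ≤ |r * x| := by
    rw [abs_mul, abs_of_nonneg (by linarith : 0 ≤ r)]
    exact le_mul_of_one_le_left (abs_nonneg x) hr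
  refine (max_le_max (hscale z.re) (hscale z.im)).not_gt ?_
  rw [show max |z.re| |z.im| = N from hz]
  exact max_lt (by simpa [hrz] using hw.1) (by simpa [hrz] using hw.2)

lemma squareIntegral_inv_sub (hw : w ∈ insideSquare N) :
    squareIntegral N (fun z => (z - w)⁻¹) = 2 * Real.pi * I := by
  have hN : 0 < N := (abs_nonneg _).trans_lt hw.1
  have hsub : logDeriv (fun z => z - w) = fun z => (z - w)⁻¹ := by
    ext z
    simp [logDeriv_apply]
  have hid : logDeriv (fun z : ℂ => z) = fun z => z⁻¹ := by
    ext z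
    simp [logDeriv_apply]
  rw [← hsub, squareIntegral_logDeriv_eq_of_div_mem_slitPlane hN.le (fun z _ => by fun_prop)
    (fun z _ => by fun_prop) (fun z hz => sub_div_mem_slitPlane hz hw), hid, squareIntegral_inv hN]

lemma finite_zerosIn_insideSquare (hf : AnalyticOnNhd ℂ f (closedSquare N))
    (hw : w ∈ closedSquare N) (hfw : f w ≠ 0) : (zerosIn f (insideSquare N)).Finite := by
  refine (isCompact_closedSquare.finite_sdiff_of_mem_codiscreteWithin
    (hf.preimage_zero_mem_codiscreteWithin hfw hw ⟨⟨w, hw⟩, isPreconnected_closedSquare⟩)).subset ?_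
  exact fun z hz => ⟨insideSquare_subset_closedSquare hz.1, by simp [hz.2]⟩

lemma analyticOrderAt_ne_top_of_mem_closedSquare (hf : AnalyticOnNhd ℂ f (closedSquare N))
    (hw : w ∈ closedSquare N) (hfw : f w ≠ 0) (hz : z ∈ closedSquare N) :
    analyticOrderAt f z ≠ ⊤ := by
  refine hf.analyticOrderAt_ne_top_of_isPreconnected isPreconnected_closedSquare hw hz ?_
  simp [(hf w hw).analyticOrderAt_eq_zero.2 hfw]

lemma zeroCount_eq_sum {V : Set ℂ} (S : Finset ℂ) (hS : ↑S ⊆ V) (h : zerosIn f V ⊆ S) :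
    zeroCount f V = ∑ z ∈ S, analyticOrderNatAt f z := by
  refine finsum_mem_eq_sum_of_inter_support_eq _ (Subset.antisymm ?_ ?_)
  · exact inter_subset_inter_left _ h
  · rintro z ⟨hz, hz'⟩
    exact ⟨⟨hS hz, apply_eq_zero_of_analyticOrderNatAt_ne_zero hz'⟩, hz'⟩

lemma zerosIn_eq_empty_of_zeroCount_eq_zero {V : Set ℂ} (hf : AnalyticOnNhd ℂ f V)
    (hfin : (zerosIn f V).Finite) (htop : ∀ z ∈ V, analyticOrderAt f z ≠ ⊤)
    (h : zeroCount f V = 0) : zerosIn f V = ∅ := by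
  refine eq_empty_of_forall_notMem fun z hz => ?_
  rw [zeroCount_eq_sum hfin.toFinset (by simp [zerosIn]) (by simp), Finset.sum_eq_zero_iff] at h
  have horder : (analyticOrderNatAt f z : ℕ∞) = 0 := by simp [h z (by simpa using hz)]
  rw [Nat.cast_analyticOrderNatAt (htop z hz.1), (hf z hz.1).analyticOrderAt_eq_zero] at horder
  exact horder hz.2

lemma analyticOnNhd_dslope {s : Set ℂ} (hf : AnalyticOnNhd ℂ f s) (hw : w ∈ s) :
    AnalyticOnNhd ℂ (dslope f w) s := by
  have hopen := isOpen_analyticAt ℂ f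
  have hdslope : DifferentiableOn ℂ (dslope f w) {z | AnalyticAt ℂ f z} :=
    (Complex.differentiableOn_dslope (hopen.mem_nhds (hf w hw))).2
      fun z hz => hz.differentiableAt.differentiableWithinAt
  exact fun z hz => hdslope.analyticAt (hopen.mem_nhds (hf z hz))

lemma eq_sub_mul_dslope (hw : f w = 0) : f = (fun z => z - w) * dslope f w := by
  ext z
  simpa [hw] using (sub_smul_dslope f w z).symm

lemma analyticOrderAt_eq_add_analyticOrderAt_dslope (hw : f w = 0)
    (hz : AnalyticAt ℂ (dslope f w) z) :
    analyticOrderAt f z = (if z = w then 1 else 0) + analyticOrderAt (dslope f w) z := by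
  conv_lhs => rw [eq_sub_mul_dslope hw]
  rw [analyticOrderAt_mul (by fun_prop) hz]
  congr 1
  split_ifs with h
  · exact h ▸ analyticOrderAt_id_sub_const_self
  · exact analyticOrderAt_id_sub_const_of_ne h

lemma zeroCount_eq_zeroCount_dslope_add_one {V : Set ℂ} (hf : AnalyticOnNhd ℂ f V)
    (hfin : (zerosIn f V).Finite) (htop : ∀ z ∈ V, analyticOrderAt f z ≠ ⊤)
    (hw : w ∈ zerosIn f V) : zeroCount f V = zeroCount (dslope f w) V + 1 := by
  have hfactor : zerosIn (dslope f w) V ⊆ zerosIn f V := fun z hz =>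
    ⟨hz.1, by rw [eq_sub_mul_dslope hw.2]; simp [hz.2]⟩
  have horder : ∀ z ∈ V, analyticOrderNatAt f z =
      (if z = w then 1 else 0) + analyticOrderNatAt (dslope f w) z := fun z hz => by
    have h := analyticOrderAt_eq_add_analyticOrderAt_dslope hw.2 (analyticOnNhd_dslope hf hw.1 z hz)
    have hdslope : analyticOrderAt (dslope f w) z ≠ ⊤ := fun h' => htop z hz (by simp [h, h'])
    rw [← Nat.cast_inj (R := ℕ∞)]
    push_cast
    rw [Nat.cast_analyticOrderNatAt (htop z hz), Nat.cast_analyticOrderNatAt hdslope, h]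
  have hsub : ↑hfin.toFinset ⊆ V := by simp [zerosIn]
  rw [zeroCount_eq_sum hfin.toFinset hsub (by simp),
    zeroCount_eq_sum hfin.toFinset hsub (by simpa using hfactor),
    Finset.sum_congr rfl fun z hz => horder z (hsub hz), Finset.sum_add_distrib,
    Finset.sum_ite_eq', if_pos (by simpa using hw), add_comm]

lemma logDeriv_eq_inv_sub_add_logDeriv_dslope (hw : f w = 0) (hz : f z ≠ 0)
    (hd : DifferentiableAt ℂ (dslope f w) z) :
    logDeriv f z = (z - w)⁻¹ + logDeriv (dslope f w) z := by
  have hfz : f z = (z - w) * dslope f w z := congrFun (eq_sub_mul_dslope hw) z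
  obtain ⟨hsub, hdslope⟩ := mul_ne_zero_iff.1 (hfz ▸ hz)
  conv_lhs => rw [eq_sub_mul_dslope hw]
  rw [show (fun z => z - w) * dslope f w = fun z => (z - w) * dslope f w z from rfl,
    logDeriv_mul z hsub hdslope (by fun_prop) hd]
  simp [logDeriv_apply]

lemma squareIntegral_logDeriv (hN : 0 < N) (hf : AnalyticOnNhd ℂ f (closedSquare N))
    (h0 : ∀ z ∈ squareContour N, f z ≠ 0) :
    squareIntegral N (logDeriv f) = zeroCount f (insideSquare N) * (2 * Real.pi * I) := by
  have hNmem := ofReal_mem_squareContour hN.le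
  have hNmem' := squareContour_subset_closedSquare hNmem
  induction hn : zeroCount f (insideSquare N) generalizing f with
  | zero =>
    have hempty := zerosIn_eq_empty_of_zeroCount_eq_zero (hf.mono insideSquare_subset_closedSquare)
      (finite_zerosIn_insideSquare hf hNmem' (h0 _ hNmem))
      (fun z hz => analyticOrderAt_ne_top_of_mem_closedSquare hf hNmem' (h0 _ hNmem)
        (insideSquare_subset_closedSquare hz)) hn
    have hne : ∀ z ∈ closedSquare N, f z ≠ 0 := by
      rw [← insideSquare_union_squareContour]
      rintro z (hz | hz)
      · exact fun h => hempty.le ⟨hz, h⟩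
      · exact h0 z hz
    have hd : DifferentiableOn ℂ (logDeriv f) (closedSquare N) :=
      hf.deriv.differentiableOn.div hf.differentiableOn hne
    rw [squareIntegral_eq_zero_of_differentiableOn hN.le hd, Nat.cast_zero, zero_mul]
  | succ n ih =>
    obtain ⟨w, hw⟩ : (zerosIn f (insideSquare N)).Nonempty := by
      by_contra hempty
      simp [zeroCount, not_nonempty_iff_eq_empty.1 hempty] at hn
    have hcount := zeroCount_eq_zeroCount_dslope_add_one
      (hf.mono insideSquare_subset_closedSquare)
      (finite_zerosIn_insideSquare hf hNmem' (h0 _ hNmem))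
      (fun z hz => analyticOrderAt_ne_top_of_mem_closedSquare hf hNmem' (h0 _ hNmem)
        (insideSquare_subset_closedSquare hz)) hw
    have hg := analyticOnNhd_dslope hf (insideSquare_subset_closedSquare hw.1)
    have hgc := hg.mono squareContour_subset_closedSquare
    have hg0 (z) (hz : z ∈ squareContour N) : dslope f w z ≠ 0 := fun h =>
      h0 z hz (by rw [eq_sub_mul_dslope hw.2]; simp [h])
    rw [squareIntegral_congr hN.le fun z hz => logDeriv_eq_inv_sub_add_logDeriv_dslope hw.2
      (h0 z hz) (hgc z hz).differentiableAt, squareIntegral_add hN.le _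
      (continuousOn_logDeriv hgc hg0), squareIntegral_inv_sub hw.1, ih hg hg0 (by omega)]
    · push_cast
      ring
    · exact ContinuousOn.inv₀ (by fun_prop) fun z hz =>
        sub_ne_zero.2 (ne_of_mem_squareContour_of_mem_insideSquare hz hw.1)

lemma zeroCount_eq_of_norm_sub_lt (hN : 0 < N) (hf : AnalyticOnNhd ℂ f (closedSquare N))
    (hg : AnalyticOnNhd ℂ g (closedSquare N))
    (h : ∀ z ∈ squareContour N, ‖f z - g z‖ < ‖g z‖) :
    (zerosIn f (insideSquare N)).Finite ∧ (zerosIn g (insideSquare N)).Finite ∧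
      zeroCount f (insideSquare N) = zeroCount g (insideSquare N) := by
  have hNmem := ofReal_mem_squareContour hN.le
  have hg0 (z) (hz : z ∈ squareContour N) : g z ≠ 0 :=
    norm_pos_iff.1 ((norm_nonneg _).trans_lt (h z hz))
  have hf0 (z) (hz : z ∈ squareContour N) : f z ≠ 0 := fun h' => by
    simpa [h'] using h z hz
  refine ⟨finite_zerosIn_insideSquare hf (squareContour_subset_closedSquare hNmem) (hf0 _ hNmem),
    finite_zerosIn_insideSquare hg (squareContour_subset_closedSquare hNmem) (hg0 _ hNmem), ?_⟩
  have hquot (z) (hz : z ∈ squareContour N) : f z / g z ∈ slitPlane := by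
    rw [← add_sub_cancel (1 : ℂ) (f z / g z), div_sub_one (hg0 z hz)]
    refine Complex.mem_slitPlane_of_norm_lt_one ?_
    rw [norm_div, div_lt_one (norm_pos_iff.2 (hg0 z hz))]
    exact h z hz
  have hI := squareIntegral_logDeriv_eq_of_div_mem_slitPlane hN.le
    (hf.mono squareContour_subset_closedSquare) (hg.mono squareContour_subset_closedSquare) hquot
  rw [squareIntegral_logDeriv hN hf hf0, squareIntegral_logDeriv hN hg hg0] at hI
  exact_mod_cast mul_right_cancel₀ Complex.two_pi_I_ne_zero hI

end Contour

section AbsolutelyContinuous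

variable {E : Type*} [NormedAddCommGroup E] [NormedSpace ℝ E] {a b : ℝ}

lemma absolutelyContinuousOnInterval_primitive {h : ℝ → E} (hh : IntervalIntegrable h volume a b) :
    AbsolutelyContinuousOnInterval (fun x => ∫ t in a..x, h t) a b := by
  have hsub : ∀ u ∈ uIcc a b, IntervalIntegrable h volume a u := fun u hu =>
    hh.mono_set (uIcc_subset_uIcc left_mem_uIcc hu)
  refine squeeze_zero' (Filter.Eventually.of_forall fun E =>
    Finset.sum_nonneg fun _ _ => dist_nonneg) ?_
    (hh.norm.absolutelyContinuousOnInterval_intervalIntegral left_mem_uIcc)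
  filter_upwards [Filter.mem_inf_of_right (Filter.mem_principal_self _)] with E hE
  refine Finset.sum_le_sum fun i hi => ?_
  obtain ⟨hl, hr⟩ := hE.1 i hi
  rw [dist_eq_norm, dist_eq_norm,
    intervalIntegral.integral_interval_sub_left (hsub _ hl) (hsub _ hr),
    intervalIntegral.integral_interval_sub_left (hsub _ hl).norm (hsub _ hr).norm,
    Real.norm_eq_abs]
  exact intervalIntegral.norm_integral_le_abs_integral_norm

variable [CompleteSpace E]

lemma hasDerivWithinAt_of_ae_hasDerivAt {f h : ℝ → E} (hf : AbsolutelyContinuousOnInterval f a b)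
    (hh : ContinuousOn h (Icc a b)) (hfh : ∀ᵐ t, t ∈ Icc a b → HasDerivAt f (h t) t)
    {x : ℝ} (hx : x ∈ Icc a b) : HasDerivWithinAt f (h x) (Icc a b) x := by
  have hab : a ≤ b := hx.1.trans hx.2
  have hint : IntervalIntegrable h volume a b := hh.intervalIntegrable_of_Icc hab
  obtain ⟨c, hc⟩ := (hf.sub
    (absolutelyContinuousOnInterval_primitive hint)).const_of_ae_hasDerivAt_zero (by
      filter_upwards [hfh, hint.ae_hasDerivAt_integral] with t h₁ h₂ ht
      simpa using (h₁ (uIcc_of_le hab ▸ ht)).sub (h₂ ht a left_mem_uIcc))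
  rw [uIcc_of_le hab] at hc
  have : Fact (x ∈ Icc a b) := ⟨hx⟩
  have hprim : HasDerivWithinAt (fun x => ∫ t in a..x, h t) (h x) (Icc a b) x :=
    intervalIntegral.integral_hasDerivWithinAt_right
      ((hh.mono (Icc_subset_Icc_right hx.2)).intervalIntegrable_of_Icc hx.1)
      (hh.stronglyMeasurableAtFilter_nhdsWithin measurableSet_Icc x) (hh x hx)
  exact (hprim.const_add c).congr_of_mem (fun z hz => sub_eq_iff_eq_add.1 (hc z hz)) hx

end AbsolutelyContinuous

section FreeSolutions

lemma sin_mul_eq_mul_sinKernel (k : ℂ) (x : ℝ) : Complex.sin (k * x) = k * sinKernel k x := by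
  unfold sinKernel
  split_ifs with h
  · simp [h]
  · field_simp

lemma cos_sq_add_sinKernel_sq (k : ℂ) (x : ℝ) :
    Complex.cos (k * x) ^ 2 + k ^ 2 * sinKernel k x ^ 2 = 1 := by
  rw [← mul_pow, ← sin_mul_eq_mul_sinKernel, Complex.cos_sq_add_sin_sq]

lemma continuous_cos_mul (k : ℂ) : Continuous fun x : ℝ => Complex.cos (k * x) := by
  fun_prop

lemma hasDerivAt_cos_mul (k : ℂ) (x : ℝ) :
    HasDerivAt (fun x : ℝ => Complex.cos (k * x)) (-(k ^ 2 * sinKernel k x)) x := by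
  refine (((hasDerivAt_id (x : ℂ)).const_mul k).ccos.comp_ofReal).congr_deriv ?_
  rw [id, sin_mul_eq_mul_sinKernel]
  ring

lemma hasDerivAt_sinKernel (k : ℂ) (x : ℝ) :
    HasDerivAt (sinKernel k) (Complex.cos (k * x)) x := by
  unfold sinKernel
  split_ifs with h
  · simpa [h] using (hasDerivAt_id (x : ℂ)).comp_ofReal
  · simpa [h] using ((((hasDerivAt_id (x : ℂ)).const_mul k).csin.div_const k).comp_ofReal)

lemma contDiff_sinKernel (k : ℂ) : ContDiff ℝ 1 (sinKernel k) := by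
  rw [contDiff_one_iff_deriv, funext fun x => (hasDerivAt_sinKernel k x).deriv]
  exact ⟨fun x => (hasDerivAt_sinKernel k x).differentiableAt, continuous_cos_mul k⟩

lemma contDiff_cos_mul (k : ℂ) : ContDiff ℝ 1 fun x : ℝ => Complex.cos (k * x) := by
  rw [contDiff_one_iff_deriv, funext fun x => (hasDerivAt_cos_mul k x).deriv]
  exact ⟨fun x => (hasDerivAt_cos_mul k x).differentiableAt,
    (continuous_const.mul (continuous_sinKernel k)).neg⟩

end FreeSolutions

section Moments

variable {ℓ : ℝ} {q : ℝ → ℝ} {y : ℝ → ℂ}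

/-- The coefficient of `sin (k x) / k` in the variation of parameters formula for
`volterraOp q k y`. -/
def cosMoment (q : ℝ → ℝ) (k : ℂ) (y : ℝ → ℂ) (x : ℝ) : ℂ :=
  ∫ t in (0 : ℝ)..x, (q t : ℂ) * (Complex.cos (k * t) * y t)

/-- The coefficient of `-cos (k x)` in the variation of parameters formula for
`volterraOp q k y`. -/
def sinMoment (q : ℝ → ℝ) (k : ℂ) (y : ℝ → ℂ) (x : ℝ) : ℂ :=
  ∫ t in (0 : ℝ)..x, (q t : ℂ) * (sinKernel k t * y t)

lemma cosMoment_zero (q : ℝ → ℝ) (k : ℂ) (y : ℝ → ℂ) : cosMoment q k y 0 = 0 :=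
  intervalIntegral.integral_same

lemma sinMoment_zero (q : ℝ → ℝ) (k : ℂ) (y : ℝ → ℂ) : sinMoment q k y 0 = 0 :=
  intervalIntegral.integral_same

lemma intervalIntegrable_mul_cos_mul (hℓ : 0 ≤ ℓ) (hq : IntervalIntegrable q volume 0 ℓ) (k : ℂ)
    (hy : ContinuousOn y (Icc 0 ℓ)) :
    IntervalIntegrable (fun t => (q t : ℂ) * (Complex.cos (k * t) * y t)) volume 0 ℓ :=
  intervalIntegrable_mul hq hℓ ((continuous_cos_mul k).continuousOn.mul hy)

lemma intervalIntegrable_mul_sinKernel_mul (hℓ : 0 ≤ ℓ) (hq : IntervalIntegrable q volume 0 ℓ)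
    (k : ℂ) (hy : ContinuousOn y (Icc 0 ℓ)) :
    IntervalIntegrable (fun t => (q t : ℂ) * (sinKernel k t * y t)) volume 0 ℓ :=
  intervalIntegrable_mul hq hℓ ((continuous_sinKernel k).continuousOn.mul hy)

lemma absolutelyContinuousOnInterval_cosMoment (hℓ : 0 ≤ ℓ) (hq : IntervalIntegrable q volume 0 ℓ)
    (k : ℂ) (hy : ContinuousOn y (Icc 0 ℓ)) :
    AbsolutelyContinuousOnInterval (cosMoment q k y) 0 ℓ :=
  absolutelyContinuousOnInterval_primitive (intervalIntegrable_mul_cos_mul hℓ hq k hy)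

lemma absolutelyContinuousOnInterval_sinMoment (hℓ : 0 ≤ ℓ) (hq : IntervalIntegrable q volume 0 ℓ)
    (k : ℂ) (hy : ContinuousOn y (Icc 0 ℓ)) :
    AbsolutelyContinuousOnInterval (sinMoment q k y) 0 ℓ :=
  absolutelyContinuousOnInterval_primitive (intervalIntegrable_mul_sinKernel_mul hℓ hq k hy)

lemma ae_hasDerivAt_cosMoment (hℓ : 0 ≤ ℓ) (hq : IntervalIntegrable q volume 0 ℓ) (k : ℂ)
    (hy : ContinuousOn y (Icc 0 ℓ)) :
    ∀ᵐ t, t ∈ Icc 0 ℓ → HasDerivAt (cosMoment q k y) (q t * (Complex.cos (k * t) * y t)) t := by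
  filter_upwards [(intervalIntegrable_mul_cos_mul hℓ hq k hy).ae_hasDerivAt_integral] with t h ht
  exact h (uIcc_of_le hℓ ▸ ht) 0 left_mem_uIcc

lemma ae_hasDerivAt_sinMoment (hℓ : 0 ≤ ℓ) (hq : IntervalIntegrable q volume 0 ℓ) (k : ℂ)
    (hy : ContinuousOn y (Icc 0 ℓ)) :
    ∀ᵐ t, t ∈ Icc 0 ℓ → HasDerivAt (sinMoment q k y) (q t * (sinKernel k t * y t)) t := by
  filter_upwards [(intervalIntegrable_mul_sinKernel_mul hℓ hq k hy).ae_hasDerivAt_integral]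
    with t h ht
  exact h (uIcc_of_le hℓ ▸ ht) 0 left_mem_uIcc

lemma volterraOp_eq_moments (hq : IntervalIntegrable q volume 0 ℓ) (k : ℂ)
    (hy : ContinuousOn y (Icc 0 ℓ)) {x : ℝ} (hx : x ∈ Icc 0 ℓ) :
    volterraOp q k y x =
      sinKernel k x * cosMoment q k y x - Complex.cos (k * x) * sinMoment q k y x :=
  volterraOp_expand hq hy hx

/-- The derivative in `x` of `volterraOp q k y x`, obtained by differentiating the kernel only. -/
def volterraDeriv (q : ℝ → ℝ) (k : ℂ) (y : ℝ → ℂ) (x : ℝ) : ℂ :=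
  ∫ t in (0 : ℝ)..x, Complex.cos (k * (x - t : ℝ)) * (q t : ℂ) * y t

lemma volterraDeriv_eq_moments (hq : IntervalIntegrable q volume 0 ℓ) (k : ℂ)
    (hy : ContinuousOn y (Icc 0 ℓ)) {x : ℝ} (hx : x ∈ Icc 0 ℓ) :
    volterraDeriv q k y x =
      Complex.cos (k * x) * cosMoment q k y x + k ^ 2 * sinKernel k x * sinMoment q k y x := by
  have hℓ : 0 ≤ ℓ := hx.1.trans hx.2
  unfold volterraDeriv cosMoment sinMoment
  rw [← intervalIntegral.integral_const_mul, ← intervalIntegral.integral_const_mul,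
    ← intervalIntegral.integral_add
      ((intervalIntegrable_sub (intervalIntegrable_mul_cos_mul hℓ hq k hy) hx).const_mul _)
      ((intervalIntegrable_sub (intervalIntegrable_mul_sinKernel_mul hℓ hq k hy) hx).const_mul _)]
  congr 1 with t
  rw [Complex.ofReal_sub, mul_sub, Complex.cos_sub, sin_mul_eq_mul_sinKernel,
    sin_mul_eq_mul_sinKernel]
  ring

lemma hasDerivWithinAt_volterraOp (hq : IntervalIntegrable q volume 0 ℓ) (k : ℂ)
    (hy : ContinuousOn y (Icc 0 ℓ)) {x : ℝ} (hx : x ∈ Icc 0 ℓ) :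
    HasDerivWithinAt (volterraOp q k y) (volterraDeriv q k y x) (Icc 0 ℓ) x := by
  have hℓ : 0 ≤ ℓ := hx.1.trans hx.2
  have hA := absolutelyContinuousOnInterval_cosMoment hℓ hq k hy
  have hB := absolutelyContinuousOnInterval_sinMoment hℓ hq k hy
  have hac : AbsolutelyContinuousOnInterval (fun x =>
      sinKernel k x * cosMoment q k y x - Complex.cos (k * x) * sinMoment q k y x) 0 ℓ :=
    ((contDiff_sinKernel k).contDiffOn.absolutelyContinuousOnInterval.smul hA).sub
      ((contDiff_cos_mul k).contDiffOn.absolutelyContinuousOnInterval.smul hB)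
  have hcont : ContinuousOn (fun x : ℝ =>
      Complex.cos (k * x) * cosMoment q k y x + k ^ 2 * sinKernel k x * sinMoment q k y x)
      (Icc 0 ℓ) := by
    rw [← uIcc_of_le hℓ]
    exact ((continuous_cos_mul k).continuousOn.mul hA.continuousOn).add
      ((continuous_const.mul (continuous_sinKernel k)).continuousOn.mul hB.continuousOn)
  have hderiv := hasDerivWithinAt_of_ae_hasDerivAt hac hcont (by
    filter_upwards [ae_hasDerivAt_cosMoment hℓ hq k hy, ae_hasDerivAt_sinMoment hℓ hq k hy]
      with t hA' hB' ht
    refine (((hasDerivAt_sinKernel k t).fun_mul (hA' ht)).fun_sub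
      ((hasDerivAt_cos_mul k t).fun_mul (hB' ht))).congr_deriv ?_
    ring) hx
  rw [volterraDeriv_eq_moments hq k hy hx]
  exact hderiv.congr_of_mem (fun z hz => volterraOp_eq_moments hq k hy hz) hx

end Moments

section FundamentalSolutions

variable {ℓ : ℝ} {q : ℝ → ℝ}

lemma continuousOn_cosSol (hq : IntervalIntegrable q volume 0 ℓ) (k : ℂ) :
    ContinuousOn (cosSol q k) (Icc 0 ℓ) :=
  continuousOn_volterraSol hq (continuous_cos_mul k).continuousOn

lemma continuousOn_sinSol (hq : IntervalIntegrable q volume 0 ℓ) (k : ℂ) :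
    ContinuousOn (sinSol q k) (Icc 0 ℓ) :=
  continuousOn_volterraSol hq (continuous_sinKernel k).continuousOn

lemma cosSol_eq_moments (hq : IntervalIntegrable q volume 0 ℓ) (k : ℂ) {x : ℝ}
    (hx : x ∈ Icc 0 ℓ) :
    cosSol q k x = Complex.cos (k * x) * (1 - sinMoment q k (cosSol q k) x) +
      sinKernel k x * cosMoment q k (cosSol q k) x := by
  have hsol : cosSol q k x = Complex.cos (k * x) + volterraOp q k (cosSol q k) x :=
    volterraSol_eq hq (continuous_cos_mul k).continuousOn hx
  linear_combination hsol + volterraOp_eq_moments hq k (continuousOn_cosSol hq k) hx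

lemma sinSol_eq_moments (hq : IntervalIntegrable q volume 0 ℓ) (k : ℂ) {x : ℝ}
    (hx : x ∈ Icc 0 ℓ) :
    sinSol q k x = sinKernel k x * (1 + cosMoment q k (sinSol q k) x) -
      Complex.cos (k * x) * sinMoment q k (sinSol q k) x := by
  have hsol : sinSol q k x = sinKernel k x + volterraOp q k (sinSol q k) x :=
    volterraSol_eq hq (continuous_sinKernel k).continuousOn hx
  linear_combination hsol + volterraOp_eq_moments hq k (continuousOn_sinSol hq k) hx

lemma derivWithin_volterraSol {k : ℂ} (hℓ : 0 < ℓ) (hq : IntervalIntegrable q volume 0 ℓ)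
    {f : ℝ → ℂ} {f' : ℂ} (hf : ContinuousOn f (Icc 0 ℓ)) (hf' : HasDerivAt f f' ℓ) :
    derivWithin (volterraSol q k f) (Icc 0 ℓ) ℓ =
      f' + volterraDeriv q k (volterraSol q k f) ℓ := by
  have hmem : ℓ ∈ Icc 0 ℓ := right_mem_Icc.2 hℓ.le
  have hderiv := hf'.hasDerivWithinAt.add
    (hasDerivWithinAt_volterraOp hq k (continuousOn_volterraSol (k := k) hq hf) hmem)
  exact (hderiv.congr_of_mem (fun z hz => volterraSol_eq hq hf hz) hmem).derivWithin
    (uniqueDiffOn_Icc hℓ ℓ hmem)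

lemma derivWithin_cosSol (hℓ : 0 < ℓ) (hq : IntervalIntegrable q volume 0 ℓ) (k : ℂ) :
    derivWithin (cosSol q k) (Icc 0 ℓ) ℓ =
      -(k ^ 2 * sinKernel k ℓ) + volterraDeriv q k (cosSol q k) ℓ :=
  derivWithin_volterraSol hℓ hq (continuous_cos_mul k).continuousOn (hasDerivAt_cos_mul k ℓ)

lemma derivWithin_sinSol (hℓ : 0 < ℓ) (hq : IntervalIntegrable q volume 0 ℓ) (k : ℂ) :
    derivWithin (sinSol q k) (Icc 0 ℓ) ℓ =
      Complex.cos (k * ℓ) + volterraDeriv q k (sinSol q k) ℓ :=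
  derivWithin_volterraSol hℓ hq (continuous_sinKernel k).continuousOn (hasDerivAt_sinKernel k ℓ)

-- In the basis `cos (k x)`, `sin (k x) / k` the moments are the coordinates of the two solutions,
-- so this determinant is their Wronskian divided by that of the basis.
lemma det_moments_eq_one (hq : IntervalIntegrable q volume 0 ℓ) (k : ℂ) {x : ℝ}
    (hx : x ∈ Icc 0 ℓ) :
    (1 - sinMoment q k (cosSol q k) x) * (1 + cosMoment q k (sinSol q k) x) +
      cosMoment q k (cosSol q k) x * sinMoment q k (sinSol q k) x = 1 := by
  have hℓ : 0 ≤ ℓ := hx.1.trans hx.2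
  have hc := continuousOn_cosSol hq k
  have hs := continuousOn_sinSol hq k
  have hone : AbsolutelyContinuousOnInterval (fun _ : ℝ => (1 : ℂ)) 0 ℓ :=
    contDiffOn_const.absolutelyContinuousOnInterval
  have hac : AbsolutelyContinuousOnInterval (fun x =>
      (1 - sinMoment q k (cosSol q k) x) * (1 + cosMoment q k (sinSol q k) x) +
        cosMoment q k (cosSol q k) x * sinMoment q k (sinSol q k) x) 0 ℓ :=
    ((hone.sub (absolutelyContinuousOnInterval_sinMoment hℓ hq k hc)).smul
      (hone.add (absolutelyContinuousOnInterval_cosMoment hℓ hq k hs))).add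
      ((absolutelyContinuousOnInterval_cosMoment hℓ hq k hc).smul
        (absolutelyContinuousOnInterval_sinMoment hℓ hq k hs))
  obtain ⟨C, hC⟩ := hac.const_of_ae_hasDerivAt_zero (by
    filter_upwards [ae_hasDerivAt_cosMoment hℓ hq k hc, ae_hasDerivAt_sinMoment hℓ hq k hc,
      ae_hasDerivAt_cosMoment hℓ hq k hs, ae_hasDerivAt_sinMoment hℓ hq k hs]
      with t hcc hsc hcs hss ht
    rw [uIcc_of_le hℓ] at ht
    refine ((((hsc ht).const_sub 1).fun_mul ((hcs ht).const_add 1)).fun_add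
      ((hcc ht).fun_mul (hss ht))).congr_deriv ?_
    linear_combination (-(q t : ℂ) * sinSol q k t) * cosSol_eq_moments hq k ht +
      ((q t : ℂ) * cosSol q k t) * sinSol_eq_moments hq k ht)
  rw [uIcc_of_le hℓ] at hC
  rw [hC x hx, ← hC 0 (left_mem_Icc.2 hℓ)]
  simp only [cosMoment_zero, sinMoment_zero, sub_zero, add_zero, mul_one, mul_zero]

lemma wronskian_eq_one (hℓ : 0 < ℓ) (hq : IntervalIntegrable q volume 0 ℓ) (k : ℂ) :
    cosSol q k ℓ * derivWithin (sinSol q k) (Icc 0 ℓ) ℓ -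
      derivWithin (cosSol q k) (Icc 0 ℓ) ℓ * sinSol q k ℓ = 1 := by
  have hmem : ℓ ∈ Icc 0 ℓ := right_mem_Icc.2 hℓ.le
  rw [derivWithin_cosSol hℓ hq, derivWithin_sinSol hℓ hq,
    volterraDeriv_eq_moments hq k (continuousOn_cosSol hq k) hmem,
    volterraDeriv_eq_moments hq k (continuousOn_sinSol hq k) hmem,
    cosSol_eq_moments hq k hmem, sinSol_eq_moments hq k hmem]
  have hdet := det_moments_eq_one hq k hmem
  linear_combination
    ((1 - sinMoment q k (cosSol q k) ℓ) * (1 + cosMoment q k (sinSol q k) ℓ) +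
      cosMoment q k (cosSol q k) ℓ * sinMoment q k (sinSol q k) ℓ) *
        cos_sq_add_sinKernel_sq k ℓ + hdet

end FundamentalSolutions

section Holomorphy

open Filter Topology

/-- A family of functions on `[0, ℓ]` that are continuous in the variable, entire in the parameter
and bounded uniformly for bounded parameters. This class is stable under the Volterra operator. -/
structure EntireFamily (ℓ : ℝ) (F : ℂ → ℝ → ℂ) : Prop where
  continuousOn : ∀ k, ContinuousOn (F k) (Icc 0 ℓ)
  differentiable : ∀ x ∈ Icc 0 ℓ, Differentiable ℂ fun k => F k x
  bounded : ∀ R : ℝ, ∃ B : ℝ, ∀ k : ℂ, ‖k‖ ≤ R → ∀ x ∈ Icc 0 ℓ, ‖F k x‖ ≤ B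

lemma aestronglyMeasurable_of_hasDerivAt {α E : Type*} [MeasurableSpace α] {μ : Measure α}
    [NormedAddCommGroup E] [NormedSpace ℂ E] {F : ℂ → α → E} {F' : α → E} {k : ℂ}
    (hF : ∀ w, AEStronglyMeasurable (F w) μ)
    (hF' : ∀ᵐ t ∂μ, HasDerivAt (fun w => F w t) (F' t) k) : AEStronglyMeasurable F' μ :=
  aestronglyMeasurable_of_tendsto_ae (𝓝[≠] (0 : ℂ))
    (f := fun h t => h⁻¹ • (F (k + h) t - F k t))
    (fun h => ((hF (k + h)).sub (hF k)).const_smul h⁻¹)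
    (hF'.mono fun _ ht => ht.tendsto_slope_zero)

lemma integral_abs_le {ℓ : ℝ} {q : ℝ → ℝ} (hq : IntervalIntegrable q volume 0 ℓ) {x : ℝ}
    (hx : x ∈ Icc 0 ℓ) : ∫ t in (0 : ℝ)..x, |q t| ≤ ∫ t in (0 : ℝ)..ℓ, |q t| :=
  intervalIntegral.integral_mono_interval le_rfl hx.1 hx.2
    (Eventually.of_forall fun _ => abs_nonneg _) hq.abs

namespace EntireFamily

variable {ℓ : ℝ} {q : ℝ → ℝ} {F G : ℂ → ℝ → ℂ}

lemma mul (hF : EntireFamily ℓ F) (hG : EntireFamily ℓ G) :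
    EntireFamily ℓ fun k x => F k x * G k x where
  continuousOn k := (hF.continuousOn k).mul (hG.continuousOn k)
  differentiable x hx := (hF.differentiable x hx).mul (hG.differentiable x hx)
  bounded R := by
    obtain ⟨A, hA⟩ := hF.bounded R
    obtain ⟨B, hB⟩ := hG.bounded R
    exact ⟨A * B, fun k hk x hx => norm_mul_le_of_le (hA k hk x hx) (hB k hk x hx)⟩

lemma mono (hF : EntireFamily ℓ F) {x : ℝ} (hx : x ≤ ℓ) : EntireFamily x F where
  continuousOn k := (hF.continuousOn k).mono (Icc_subset_Icc_right hx)
  differentiable t ht := hF.differentiable t ⟨ht.1, ht.2.trans hx⟩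
  bounded R :=
    (hF.bounded R).imp fun _ hB k hk t ht => hB k hk t ⟨ht.1, ht.2.trans hx⟩

lemma reflect (hF : EntireFamily ℓ F) : EntireFamily ℓ fun k t => F k (ℓ - t) := by
  have hmaps : MapsTo (fun t => ℓ - t) (Icc 0 ℓ) (Icc 0 ℓ) := fun t ht =>
    ⟨sub_nonneg.2 ht.2, sub_le_self ℓ ht.1⟩
  exact
    { continuousOn := fun k => (hF.continuousOn k).comp (by fun_prop) hmaps
      differentiable := fun t ht => hF.differentiable _ (hmaps ht)
      bounded := fun R => (hF.bounded R).imp fun _ hB k hk t ht => hB k hk _ (hmaps ht) }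

lemma exists_norm_deriv_le (hF : EntireFamily ℓ F) (R : ℝ) :
    ∃ B : ℝ, ∀ k : ℂ, ‖k‖ ≤ R → ∀ x ∈ Icc 0 ℓ, ‖deriv (fun k => F k x) k‖ ≤ B := by
  obtain ⟨B, hB⟩ := hF.bounded (R + 1)
  refine ⟨B, fun k hk x hx => ?_⟩
  have hsphere : ∀ z ∈ Metric.sphere k 1, ‖F z x‖ ≤ B := fun z hz => by
    have := norm_sub_norm_le z k
    rw [mem_sphere_iff_norm.1 hz] at this
    exact hB z (by linarith) x hx
  simpa using Complex.norm_deriv_le_of_forall_mem_sphere_norm_le one_pos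
    (hF.differentiable x hx).diffContOnCl hsphere

lemma differentiable_integral_mul (hℓ : 0 ≤ ℓ) (hq : IntervalIntegrable q volume 0 ℓ)
    (hF : EntireFamily ℓ F) :
    Differentiable ℂ fun k => ∫ t in (0 : ℝ)..ℓ, (q t : ℂ) * F k t := by
  intro k₀
  obtain ⟨B, hB⟩ := hF.exists_norm_deriv_le (‖k₀‖ + 1)
  have hmem : ∀ t ∈ uIoc 0 ℓ, t ∈ Icc 0 ℓ := fun t ht =>
    Ioc_subset_Icc_self (uIoc_of_le hℓ ▸ ht)
  have hint : ∀ k, IntervalIntegrable (fun t => (q t : ℂ) * F k t) volume 0 ℓ := fun k =>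
    intervalIntegrable_mul hq hℓ (hF.continuousOn k)
  have hmeas : ∀ k, AEStronglyMeasurable (fun t => (q t : ℂ) * F k t)
      (volume.restrict (uIoc 0 ℓ)) := fun k => (hint k).aestronglyMeasurable_restrict_uIoc
  have hderiv : ∀ t ∈ uIoc 0 ℓ, ∀ k, HasDerivAt (fun k => (q t : ℂ) * F k t)
      ((q t : ℂ) * deriv (fun k => F k t) k) k := fun t ht k =>
    (hF.differentiable t (hmem t ht) k).hasDerivAt.const_mul _
  refine (intervalIntegral.hasDerivAt_integral_of_dominated_loc_of_deriv_le
    (F' := fun k t => (q t : ℂ) * deriv (fun k => F k t) k) (bound := fun t => |q t| * B)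
    (Metric.ball_mem_nhds k₀ one_pos) (Eventually.of_forall hmeas) (hint k₀)
    (aestronglyMeasurable_of_hasDerivAt hmeas (ae_restrict_of_forall_mem measurableSet_uIoc
      fun t ht => hderiv t ht k₀))
    (Eventually.of_forall fun t ht k hk => ?_) (hq.abs.mul_const B)
    (Eventually.of_forall fun t ht k _ => hderiv t ht k)).2.differentiableAt
  have hk' : ‖k‖ ≤ ‖k₀‖ + 1 := by
    linarith [norm_sub_norm_le k k₀, mem_ball_iff_norm.1 hk]
  rw [norm_mul, Complex.norm_real, Real.norm_eq_abs]
  gcongr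
  exact hB k hk' t (hmem t ht)

end EntireFamily

lemma norm_exp_mul_I_le (z : ℂ) : ‖Complex.exp (z * Complex.I)‖ ≤ Real.exp |z.im| := by
  rw [Complex.norm_exp, Complex.mul_I_re]
  exact Real.exp_le_exp.2 (neg_le_abs _)

lemma norm_cos_le_exp (z : ℂ) : ‖Complex.cos z‖ ≤ Real.exp |z.im| := by
  rw [Complex.cos, norm_div, Complex.norm_ofNat, div_le_iff₀ two_pos, mul_two]
  simpa using norm_add_le_of_le (norm_exp_mul_I_le z) (norm_exp_mul_I_le (-z))

lemma norm_sin_le_exp (z : ℂ) : ‖Complex.sin z‖ ≤ Real.exp |z.im| := by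
  rw [Complex.sin, norm_div, Complex.norm_ofNat, div_le_iff₀ two_pos, mul_two, norm_mul,
    Complex.norm_I, mul_one]
  simpa using norm_sub_le_of_le (norm_exp_mul_I_le (-z)) (norm_exp_mul_I_le z)

lemma norm_cos_mul_le_exp (k : ℂ) {x : ℝ} (hx : 0 ≤ x) :
    ‖Complex.cos (k * x)‖ ≤ Real.exp (|k.im| * x) := by
  simpa [abs_mul, abs_of_nonneg hx] using norm_cos_le_exp (k * x)

lemma norm_sin_mul_le_exp (k : ℂ) {x : ℝ} (hx : 0 ≤ x) :
    ‖Complex.sin (k * x)‖ ≤ Real.exp (|k.im| * x) := by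
  simpa [abs_mul, abs_of_nonneg hx] using norm_sin_le_exp (k * x)

lemma differentiable_sinKernel (x : ℝ) : Differentiable ℂ fun k => sinKernel k x := by
  have hdslope : (fun k => sinKernel k x) = dslope (fun k : ℂ => Complex.sin (k * x)) 0 := by
    ext k
    rcases eq_or_ne k 0 with rfl | hk
    · rw [dslope_same, (hasDerivAt_mul_const (x : ℂ)).csin.deriv]
      simp [sinKernel]
    · rw [dslope_of_ne _ hk, slope_def_field]
      simp [sinKernel, hk]
  rw [hdslope, ← differentiableOn_univ, Complex.differentiableOn_dslope Filter.univ_mem]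
  fun_prop

lemma entireFamily_cos (ℓ : ℝ) : EntireFamily ℓ fun k x => Complex.cos (k * x) where
  continuousOn k := (continuous_cos_mul k).continuousOn
  differentiable x _ := by fun_prop
  bounded R := by
    refine ⟨Real.exp (R * ℓ), fun k hk x hx =>
      (norm_cos_mul_le_exp k hx.1).trans (Real.exp_le_exp.2 ?_)⟩
    exact mul_le_mul ((Complex.abs_im_le_norm k).trans hk) hx.2 hx.1 ((norm_nonneg k).trans hk)

lemma entireFamily_sinKernel (ℓ : ℝ) : EntireFamily ℓ sinKernel where
  continuousOn k := (continuous_sinKernel k).continuousOn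
  differentiable x _ := differentiable_sinKernel x
  bounded R := by
    obtain ⟨B, hB⟩ := (entireFamily_cos ℓ).bounded R
    refine ⟨B * ℓ, fun k hk x hx => ?_⟩
    have h0 : (0 : ℝ) ∈ Icc 0 ℓ := left_mem_Icc.2 (hx.1.trans hx.2)
    have hmvt := (convex_Icc 0 ℓ).norm_image_sub_le_of_norm_hasDerivWithin_le
      (fun t _ => (hasDerivAt_sinKernel k t).hasDerivWithinAt) (hB k hk) h0 hx
    rw [show sinKernel k 0 = 0 by simp [sinKernel], sub_zero, sub_zero,
      Real.norm_of_nonneg hx.1] at hmvt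
    exact hmvt.trans (mul_le_mul_of_nonneg_left hx.2 ((norm_nonneg _).trans (hB k hk 0 h0)))

namespace EntireFamily

variable {ℓ : ℝ} {q : ℝ → ℝ} {F : ℂ → ℝ → ℂ}

lemma exists_iterate_bound (hq : IntervalIntegrable q volume 0 ℓ) (hF : EntireFamily ℓ F)
    (R : ℝ) :
    ∃ u : ℕ → ℝ, Summable u ∧ ∀ n, ∀ k : ℂ, ‖k‖ ≤ R → ∀ x ∈ Icc 0 ℓ,
      ‖((QGraph.volterraOp q k)^[n] (F k)) x‖ ≤ u n := by
  obtain ⟨M, hM⟩ := (entireFamily_sinKernel ℓ).bounded R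
  obtain ⟨B, hB⟩ := hF.bounded R
  refine ⟨fun n => B * ((M * ∫ t in (0 : ℝ)..ℓ, |q t|) ^ n / n.factorial),
    (Real.summable_pow_div_factorial _).mul_left _, fun n k hk x hx => ?_⟩
  have hM0 : 0 ≤ M := (norm_nonneg _).trans (hM k hk x hx)
  have hB0 : 0 ≤ B := (norm_nonneg _).trans (hB k hk x hx)
  have hQ0 : 0 ≤ ∫ t in (0 : ℝ)..x, |q t| :=
    intervalIntegral.integral_nonneg hx.1 fun t _ => abs_nonneg _
  refine (iterate_bound hq (hM k hk) (hB k hk) n x hx).trans ?_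
  rw [mul_div_assoc]
  dsimp only
  gcongr
  exact integral_abs_le hq hx

protected lemma volterraOp (hq : IntervalIntegrable q volume 0 ℓ) (hF : EntireFamily ℓ F) :
    EntireFamily ℓ fun k => volterraOp q k (F k) where
  continuousOn k := continuousOn_volterraOp hq (hF.continuousOn k)
  bounded R := by
    obtain ⟨u, -, hu⟩ := hF.exists_iterate_bound hq R
    exact ⟨u 1, hu 1⟩
  differentiable x hx := by
    have hqx : IntervalIntegrable q volume 0 x :=
      hq.mono_set (uIcc_subset_uIcc_left (uIcc_of_le (hx.1.trans hx.2) ▸ hx))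
    convert ((entireFamily_sinKernel x).reflect.mul (hF.mono hx.2)).differentiable_integral_mul
      hx.1 hqx using 2 with k
    unfold QGraph.volterraOp
    congr 1 with t
    ring

protected lemma iterate_volterraOp (hq : IntervalIntegrable q volume 0 ℓ)
    (hF : EntireFamily ℓ F) (n : ℕ) : EntireFamily ℓ fun k => (volterraOp q k)^[n] (F k) := by
  induction n with
  | zero => simpa using hF
  | succ n ih => simpa only [Function.iterate_succ_apply'] using ih.volterraOp hq

protected lemma volterraSol (hq : IntervalIntegrable q volume 0 ℓ) (hF : EntireFamily ℓ F) :
    EntireFamily ℓ fun k => volterraSol q k (F k) where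
  continuousOn k := continuousOn_volterraSol hq (hF.continuousOn k)
  differentiable x hx k := by
    obtain ⟨u, hu, hb⟩ := hF.exists_iterate_bound hq (‖k‖ + 1)
    have hball := Complex.differentiableOn_tsum_of_summable_norm
      (U := Metric.ball 0 (‖k‖ + 1)) hu
      (fun n => ((hF.iterate_volterraOp hq n).differentiable x hx).differentiableOn)
      Metric.isOpen_ball (fun n w hw => hb n w (mem_ball_zero_iff.1 hw).le x hx)
    exact hball.differentiableAt (Metric.isOpen_ball.mem_nhds (by simp))
  bounded R := by
    obtain ⟨u, hu, hb⟩ := hF.exists_iterate_bound hq R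
    exact ⟨∑' n, u n, fun k hk x hx => tsum_of_norm_bounded hu.hasSum fun n => hb n k hk x hx⟩

lemma differentiable_volterraDeriv (hℓ : 0 ≤ ℓ) (hq : IntervalIntegrable q volume 0 ℓ)
    (hF : EntireFamily ℓ F) : Differentiable ℂ fun k => volterraDeriv q k (F k) ℓ := by
  convert ((entireFamily_cos ℓ).reflect.mul hF).differentiable_integral_mul hℓ hq using 2 with k
  unfold volterraDeriv
  congr 1 with t
  ring

end EntireFamily

section FundamentalSolutions

variable {ℓ : ℝ} {q : ℝ → ℝ}

lemma entireFamily_cosSol (hq : IntervalIntegrable q volume 0 ℓ) : EntireFamily ℓ (cosSol q) :=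
  (entireFamily_cos ℓ).volterraSol hq

lemma entireFamily_sinSol (hq : IntervalIntegrable q volume 0 ℓ) : EntireFamily ℓ (sinSol q) :=
  (entireFamily_sinKernel ℓ).volterraSol hq

lemma differentiable_derivWithin_cosSol (hℓ : 0 < ℓ) (hq : IntervalIntegrable q volume 0 ℓ) :
    Differentiable ℂ fun k => derivWithin (cosSol q k) (Icc 0 ℓ) ℓ := by
  have hsin := differentiable_sinKernel ℓ
  have hvolterra := (entireFamily_cosSol hq).differentiable_volterraDeriv hℓ.le hq
  simp_rw [derivWithin_cosSol hℓ hq]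
  fun_prop

lemma differentiable_derivWithin_sinSol (hℓ : 0 < ℓ) (hq : IntervalIntegrable q volume 0 ℓ) :
    Differentiable ℂ fun k => derivWithin (sinSol q k) (Icc 0 ℓ) ℓ := by
  have hvolterra := (entireFamily_sinSol hq).differentiable_volterraDeriv hℓ.le hq
  simp_rw [derivWithin_sinSol hℓ hq]
  fun_prop

end FundamentalSolutions

end Holomorphy

section Asymptotics

open Filter Asymptotics Bornology

variable {ℓ : ℝ} {q : ℝ → ℝ} {k : ℂ}

lemma norm_integral_mul_mul_le {x : ℝ} (hx : 0 ≤ x) (hq : IntervalIntegrable q volume 0 x)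
    {κ y : ℝ → ℂ} {τ a m : ℝ} (hκ : ∀ t ∈ Ioc 0 x, ‖κ t‖ ≤ a * Real.exp (τ * (x - t)))
    (hy : ∀ t ∈ Ioc 0 x, ‖y t‖ ≤ m * Real.exp (τ * t)) :
    ‖∫ t in (0 : ℝ)..x, κ t * (q t : ℂ) * y t‖ ≤
      a * m * Real.exp (τ * x) * ∫ t in (0 : ℝ)..x, |q t| := by
  rw [← intervalIntegral.integral_const_mul]
  refine intervalIntegral.norm_integral_le_of_norm_le hx (Eventually.of_forall fun t ht => ?_)
    (hq.abs.const_mul _)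
  have hexp : Real.exp (τ * (x - t)) * Real.exp (τ * t) = Real.exp (τ * x) := by
    rw [← Real.exp_add, mul_sub, sub_add_cancel]
  calc ‖κ t * (q t : ℂ) * y t‖
      ≤ a * Real.exp (τ * (x - t)) * |q t| * (m * Real.exp (τ * t)) :=
        norm_mul_le_of_le (norm_mul_le_of_le (hκ t ht) (Complex.norm_real _).le) (hy t ht)
    _ = a * m * Real.exp (τ * x) * |q t| := by
        rw [← hexp]
        ring

lemma norm_sinKernel_le (hk : k ≠ 0) {x : ℝ} (hx : 0 ≤ x) :
    ‖sinKernel k x‖ ≤ ‖k‖⁻¹ * Real.exp (|k.im| * x) := by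
  rw [sinKernel, if_neg hk, norm_div, div_eq_inv_mul]
  exact mul_le_mul_of_nonneg_left (norm_sin_mul_le_exp k hx) (inv_nonneg.2 (norm_nonneg k))

lemma norm_volterraOp_le (hq : IntervalIntegrable q volume 0 ℓ) (hk : k ≠ 0)
    (hqk : 2 * ∫ t in (0 : ℝ)..ℓ, |q t| ≤ ‖k‖) {y : ℝ → ℂ} {m : ℝ}
    (hy : ∀ x ∈ Icc 0 ℓ, ‖y x‖ ≤ m * Real.exp (|k.im| * x)) {x : ℝ} (hx : x ∈ Icc 0 ℓ) :
    ‖volterraOp q k y x‖ ≤ m / 2 * Real.exp (|k.im| * x) := by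
  have hqx : IntervalIntegrable q volume 0 x :=
    hq.mono_set (uIcc_subset_uIcc_left (uIcc_of_le (hx.1.trans hx.2) ▸ hx))
  have hint := norm_integral_mul_mul_le hx.1 hqx
    (fun t ht => norm_sinKernel_le hk (sub_nonneg.2 ht.2))
    (fun t ht => hy t ⟨ht.1.le, ht.2.trans hx.2⟩)
  have hsmall : ‖k‖⁻¹ * ∫ t in (0 : ℝ)..x, |q t| ≤ 1 / 2 := by
    rw [inv_mul_le_iff₀ (norm_pos_iff.2 hk)]
    linarith [integral_abs_le hq hx]
  calc ‖volterraOp q k y x‖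
      ≤ ‖k‖⁻¹ * m * Real.exp (|k.im| * x) * ∫ t in (0 : ℝ)..x, |q t| := hint
    _ = m * Real.exp (|k.im| * x) * (‖k‖⁻¹ * ∫ t in (0 : ℝ)..x, |q t|) := by ring
    _ ≤ m * Real.exp (|k.im| * x) * (1 / 2) :=
        mul_le_mul_of_nonneg_left hsmall ((norm_nonneg _).trans (hy x hx))
    _ = m / 2 * Real.exp (|k.im| * x) := by ring

lemma norm_iterate_volterraOp_le (hq : IntervalIntegrable q volume 0 ℓ) (hk : k ≠ 0)
    (hqk : 2 * ∫ t in (0 : ℝ)..ℓ, |q t| ≤ ‖k‖) {f : ℝ → ℂ} {m : ℝ}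
    (hf : ∀ x ∈ Icc 0 ℓ, ‖f x‖ ≤ m * Real.exp (|k.im| * x)) (n : ℕ) :
    ∀ x ∈ Icc 0 ℓ, ‖((volterraOp q k)^[n] f) x‖ ≤ m / 2 ^ n * Real.exp (|k.im| * x) := by
  induction n with
  | zero => simpa using hf
  | succ n ih =>
    intro x hx
    rw [Function.iterate_succ_apply', pow_succ, ← div_div]
    exact norm_volterraOp_le hq hk hqk ih hx

lemma norm_volterraSol_le (hq : IntervalIntegrable q volume 0 ℓ) (hk : k ≠ 0)
    (hqk : 2 * ∫ t in (0 : ℝ)..ℓ, |q t| ≤ ‖k‖) {f : ℝ → ℂ} {m : ℝ}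
    (hf : ∀ x ∈ Icc 0 ℓ, ‖f x‖ ≤ m * Real.exp (|k.im| * x)) {x : ℝ} (hx : x ∈ Icc 0 ℓ) :
    ‖volterraSol q k f x‖ ≤ 2 * m * Real.exp (|k.im| * x) := by
  have hgeom : HasSum (fun n : ℕ => m / 2 ^ n * Real.exp (|k.im| * x))
      (2 * m * Real.exp (|k.im| * x)) := by
    simpa [div_div, mul_comm] using
      (hasSum_geometric_two' (2 * m)).mul_right (Real.exp (|k.im| * x))
  exact tsum_of_norm_bounded hgeom fun n => norm_iterate_volterraOp_le hq hk hqk hf n x hx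

lemma norm_volterraDeriv_le (hℓ : 0 ≤ ℓ) (hq : IntervalIntegrable q volume 0 ℓ) {y : ℝ → ℂ}
    {m : ℝ} (hy : ∀ x ∈ Icc 0 ℓ, ‖y x‖ ≤ m * Real.exp (|k.im| * x)) :
    ‖volterraDeriv q k y ℓ‖ ≤ (m * ∫ t in (0 : ℝ)..ℓ, |q t|) * Real.exp (|k.im| * ℓ) := by
  refine (norm_integral_mul_mul_le hℓ hq (a := 1)
    (fun t ht => (norm_cos_mul_le_exp k (sub_nonneg.2 ht.2)).trans_eq (one_mul _).symm)
    fun t ht => hy t (Ioc_subset_Icc_self ht)).trans_eq ?_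
  ring

lemma eventually_norm_cosSol_le (hq : IntervalIntegrable q volume 0 ℓ) :
    ∀ᶠ k : ℂ in cobounded ℂ, ∀ x ∈ Icc 0 ℓ, ‖cosSol q k x‖ ≤ 2 * Real.exp (|k.im| * x) := by
  filter_upwards [eventually_ne_cobounded 0,
    tendsto_norm_cobounded_atTop.eventually_ge_atTop (2 * ∫ t in (0 : ℝ)..ℓ, |q t|)]
    with k hk hqk x hx
  have hcos : ∀ x ∈ Icc 0 ℓ, ‖Complex.cos (k * x)‖ ≤ 1 * Real.exp (|k.im| * x) := fun x hx =>
    (norm_cos_mul_le_exp k hx.1).trans_eq (one_mul _).symm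
  exact (norm_volterraSol_le hq hk hqk hcos hx).trans_eq (by rw [mul_one])

lemma eventually_norm_sinSol_le (hq : IntervalIntegrable q volume 0 ℓ) :
    ∀ᶠ k : ℂ in cobounded ℂ, ∀ x ∈ Icc 0 ℓ, ‖sinSol q k x‖ ≤ 2 * Real.exp (|k.im| * x) := by
  filter_upwards [eventually_ne_cobounded 0, tendsto_norm_cobounded_atTop.eventually_ge_atTop 1,
    tendsto_norm_cobounded_atTop.eventually_ge_atTop (2 * ∫ t in (0 : ℝ)..ℓ, |q t|)]
    with k hk hk1 hqk x hx
  have hsin : ∀ x ∈ Icc 0 ℓ, ‖sinKernel k x‖ ≤ 1 * Real.exp (|k.im| * x) := fun x hx =>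
    (norm_sinKernel_le hk hx.1).trans
      (mul_le_mul_of_nonneg_right (inv_le_one_of_one_le₀ hk1) (Real.exp_nonneg _))
  exact (norm_volterraSol_le hq hk hqk hsin hx).trans_eq (by rw [mul_one])

lemma isBigO_cosSol (hℓ : 0 ≤ ℓ) (hq : IntervalIntegrable q volume 0 ℓ) :
    (fun k => cosSol q k ℓ) =O[cobounded ℂ] fun k => Real.exp (|k.im| * ℓ) := by
  refine IsBigO.of_bound 2 ?_
  filter_upwards [eventually_norm_cosSol_le hq] with k hk
  simpa using hk ℓ (right_mem_Icc.2 hℓ)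

lemma isBigO_derivWithin_sinSol (hℓ : 0 < ℓ) (hq : IntervalIntegrable q volume 0 ℓ) :
    (fun k => derivWithin (sinSol q k) (Icc 0 ℓ) ℓ) =O[cobounded ℂ]
      fun k => Real.exp (|k.im| * ℓ) := by
  refine IsBigO.of_bound (1 + 2 * ∫ t in (0 : ℝ)..ℓ, |q t|) ?_
  filter_upwards [eventually_norm_sinSol_le hq] with k hk
  rw [derivWithin_sinSol hℓ hq, Real.norm_eq_abs, Real.abs_exp, add_mul, one_mul]
  exact norm_add_le_of_le (norm_cos_mul_le_exp k hℓ.le) (norm_volterraDeriv_le hℓ.le hq hk)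

lemma isBigO_derivWithin_cosSol_sub (hℓ : 0 < ℓ) (hq : IntervalIntegrable q volume 0 ℓ) :
    (fun k => derivWithin (cosSol q k) (Icc 0 ℓ) ℓ - -k * Complex.sin (k * ℓ)) =O[cobounded ℂ]
      fun k => Real.exp (|k.im| * ℓ) := by
  refine IsBigO.of_bound (2 * ∫ t in (0 : ℝ)..ℓ, |q t|) ?_
  filter_upwards [eventually_norm_cosSol_le hq] with k hk
  have hsub : derivWithin (cosSol q k) (Icc 0 ℓ) ℓ - -k * Complex.sin (k * ℓ) =
      volterraDeriv q k (cosSol q k) ℓ := by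
    rw [derivWithin_cosSol hℓ hq, sin_mul_eq_mul_sinKernel]
    ring
  rw [hsub, Real.norm_eq_abs, Real.abs_exp]
  exact norm_volterraDeriv_le hℓ.le hq hk

lemma le_abs_sin_of_forall_notMem_Ioo {a ε : ℝ} (ha : 0 ≤ a)
    (h : ∀ n : ℕ, a ∉ Ioo (n * Real.pi - ε) (n * Real.pi + ε)) :
    2 / Real.pi * ε ≤ |Real.sin a| := by
  have hπ := Real.pi_pos
  obtain ⟨n, hn⟩ : ∃ n : ℕ, round (a / Real.pi) = n := by
    refine Int.eq_ofNat_of_zero_le ?_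
    rw [round_eq]
    exact Int.floor_nonneg.2 (by positivity)
  have hnear : |a - n * Real.pi| ≤ Real.pi / 2 := by
    have hround : |a / Real.pi - n| ≤ 1 / 2 := by
      simpa only [hn, Int.cast_natCast] using abs_sub_round (a / Real.pi)
    rw [show a - n * Real.pi = (a / Real.pi - n) * Real.pi by field_simp, abs_mul, abs_of_pos hπ]
    linarith [mul_le_mul_of_nonneg_right hround hπ.le]
  have hfar : ε ≤ |a - n * Real.pi| := by
    by_contra! hlt
    rw [abs_lt] at hlt
    exact h n ⟨by linarith, by linarith⟩
  calc 2 / Real.pi * ε ≤ 2 / Real.pi * |a - n * Real.pi| := by gcongr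
    _ ≤ |Real.sin (a - n * Real.pi)| := Real.mul_abs_le_abs_sin hnear
    _ = |Real.sin a| := by simp [Real.sin_sub_nat_mul_pi, abs_mul]

lemma sq_norm_sin (z : ℂ) :
    ‖Complex.sin z‖ ^ 2 = Real.sin z.re ^ 2 + Real.sinh z.im ^ 2 := by
  have hsin : Complex.sin z = ((Real.sin z.re * Real.cosh z.im : ℝ) : ℂ) +
      ((Real.cos z.re * Real.sinh z.im : ℝ) : ℂ) * Complex.I := by
    rw [Complex.sin_eq]
    push_cast
    ring
  rw [Complex.sq_norm, hsin, Complex.normSq_add_mul_I]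
  linear_combination Real.sin z.re ^ 2 * Real.cosh_sq z.im +
    Real.sinh z.im ^ 2 * Real.sin_sq_add_cos_sq z.re

lemma abs_sin_re_mul_exp_le_norm_sin (z : ℂ) :
    |Real.sin z.re| / 2 * Real.exp |z.im| ≤ ‖Complex.sin z‖ := by
  have hcosh : Real.exp |z.im| / 2 ≤ Real.cosh z.im := by
    rw [← Real.cosh_abs, Real.cosh_eq]
    linarith [Real.exp_pos (-|z.im|)]
  calc |Real.sin z.re| / 2 * Real.exp |z.im| = |Real.sin z.re| * (Real.exp |z.im| / 2) := by ring
    _ ≤ |Real.sin z.re| * Real.cosh z.im := by gcongr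
    _ ≤ ‖Complex.sin z‖ := by
      refine le_of_sq_le_sq ?_ (norm_nonneg _)
      rw [mul_pow, sq_abs, sq_norm_sin, Real.cosh_sq]
      nlinarith [Real.sin_sq_le_one z.re, sq_nonneg (Real.sinh z.im)]

lemma exp_le_norm_sin {z : ℂ} (hz : 1 ≤ |z.im|) :
    1 / 4 * Real.exp |z.im| ≤ ‖Complex.sin z‖ := by
  have hsinh : 1 / 4 * Real.exp |z.im| ≤ Real.sinh |z.im| := by
    have hexp : 2 ≤ Real.exp |z.im| := by linarith [Real.add_one_le_exp |z.im|]
    have hexp' : Real.exp (-|z.im|) ≤ 1 := Real.exp_le_one_iff.2 (by linarith)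
    rw [Real.sinh_eq]
    linarith
  refine hsinh.trans (le_of_sq_le_sq ?_ (norm_nonneg _))
  rw [← Real.abs_sinh, sq_abs, sq_norm_sin]
  linarith [sq_nonneg (Real.sin z.re)]

lemma mul_exp_le_norm_sin {z : ℂ} {ε : ℝ} (hz : 1 ≤ max |z.re| |z.im|)
    (h : ∀ n : ℕ, max |z.re| |z.im| ∉ Ioo (n * Real.pi - ε) (n * Real.pi + ε)) :
    min (ε / Real.pi) (1 / 4) * Real.exp |z.im| ≤ ‖Complex.sin z‖ := by
  rcases max_choice |z.re| |z.im| with hre | him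
  · rw [hre] at h
    refine le_trans ?_ (abs_sin_re_mul_exp_le_norm_sin z)
    gcongr
    have habs : |Real.sin (|z.re|)| = |Real.sin z.re| := by
      rcases abs_choice z.re with habs | habs <;> simp [habs]
    refine (min_le_left _ _).trans ?_
    rw [← habs, le_div_iff₀ two_pos]
    exact (le_abs_sin_of_forall_notMem_Ioo (abs_nonneg _) h).trans_eq' (by ring)
  · rw [him] at hz
    refine le_trans ?_ (exp_le_norm_sin hz)
    gcongr
    exact min_le_right _ _

/-- The union of the square contours whose half side `N` is `ε / ℓ`-away from all `n π / ℓ`. -/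
def admissible (ℓ ε : ℝ) : Set ℂ :=
  {k | ∀ n : ℕ, max |k.re| |k.im| ∉ Ioo (n * Real.pi / ℓ - ε / ℓ) (n * Real.pi / ℓ + ε / ℓ)}

lemma isBigO_exp_sin (hℓ : 0 < ℓ) {ε : ℝ} (hε : 0 < ε) :
    (fun k : ℂ => Real.exp (|k.im| * ℓ)) =O[cobounded ℂ ⊓ 𝓟 (admissible ℓ ε)]
      fun k => Complex.sin (k * ℓ) := by
  have hδ : 0 < min (ε / Real.pi) (1 / 4) := lt_min (div_pos hε Real.pi_pos) (by norm_num)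
  refine IsBigO.of_bound (min (ε / Real.pi) (1 / 4))⁻¹ ?_
  rw [eventually_inf_principal]
  filter_upwards [tendsto_norm_cobounded_atTop.eventually_ge_atTop (2 / ℓ)] with k hk hadm
  have him : |(k * ℓ).im| = |k.im| * ℓ := by simp [abs_mul, abs_of_pos hℓ]
  have hmax : max |(k * ℓ).re| |(k * ℓ).im| = max |k.re| |k.im| * ℓ := by
    simp [abs_mul, abs_of_pos hℓ, max_mul_of_nonneg _ _ hℓ.le]
  rw [Real.norm_eq_abs, Real.abs_exp, ← div_eq_inv_mul, le_div_iff₀' hδ, ← him]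
  refine mul_exp_le_norm_sin ?_ fun n hn => hadm n ?_
  · have hnorm : ‖k‖ ≤ 2 * max |k.re| |k.im| := by
      linarith [Complex.norm_le_abs_re_add_abs_im k, le_max_left |k.re| |k.im|,
        le_max_right |k.re| |k.im|]
    rw [hmax, ← div_le_iff₀ hℓ]
    linarith [show 2 / ℓ = 2 * (1 / ℓ) by ring]
  · rwa [hmax, mem_Ioo, ← div_lt_iff₀ hℓ, ← lt_div_iff₀ hℓ, sub_div, add_div] at hn

end Asymptotics

section EdgeDiagonal

variable {ι n R : Type*} [DecidableEq ι]

/-- The block diagonal matrix with the blocks `A i`, with the block index as the first component of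
the row and column indices; `Matrix.blockDiagonal` has it as the second one. -/
def edgeDiagonal [Zero R] (A : ι → Matrix n n R) : Matrix (ι × n) (ι × n) R :=
  (Matrix.blockDiagonal A).submatrix Prod.swap Prod.swap

lemma edgeDiagonal_zero [Zero R] : edgeDiagonal (0 : ι → Matrix n n R) = 0 := by
  rw [edgeDiagonal, Matrix.blockDiagonal_zero, Matrix.submatrix_zero]
  rfl

lemma edgeDiagonal_mul [Fintype ι] [Fintype n] [NonUnitalNonAssocSemiring R]
    (A B : ι → Matrix n n R) :
    edgeDiagonal A * edgeDiagonal B = edgeDiagonal fun i => A i * B i := by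
  rw [edgeDiagonal, edgeDiagonal, edgeDiagonal, Matrix.blockDiagonal_mul]
  exact Matrix.submatrix_mul_equiv _ _ _ (Equiv.prodComm _ _) _

lemma det_edgeDiagonal [Fintype ι] [Fintype n] [DecidableEq n] [CommRing R]
    (A : ι → Matrix n n R) : (edgeDiagonal A).det = ∏ i, (A i).det :=
  (Matrix.det_submatrix_equiv_self (Equiv.prodComm _ _) _).trans (Matrix.det_blockDiagonal A)

lemma continuous_edgeDiagonal [Zero R] [TopologicalSpace R] :
    Continuous (edgeDiagonal : (ι → Matrix n n R) → Matrix (ι × n) (ι × n) R) :=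
  (continuous_id.matrix_blockDiagonal).matrix_submatrix _ _

end EdgeDiagonal

section Differentiability

variable {𝕜 E ι n : Type*} [NontriviallyNormedField 𝕜] [NormedAddCommGroup E] [NormedSpace 𝕜 E]

lemma differentiable_det [Fintype n] [DecidableEq n] {A : E → Matrix n n 𝕜}
    (hA : ∀ i j, Differentiable 𝕜 fun x => A x i j) : Differentiable 𝕜 fun x => (A x).det := by
  simp only [Matrix.det_apply]
  fun_prop

lemma differentiable_edgeDiagonal [DecidableEq ι] {A : E → ι → Matrix n n 𝕜}
    (hA : ∀ i a b, Differentiable 𝕜 fun x => A x i a b) (p r : ι × n) :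
    Differentiable 𝕜 fun x => edgeDiagonal (A x) p r := by
  simp only [edgeDiagonal, Matrix.submatrix_apply, Matrix.blockDiagonal_apply]
  split_ifs
  · exact hA _ _ _
  · exact differentiable_const 0

end Differentiability

section SingleEdge

open Filter Topology Asymptotics Bornology

variable {ℓ : ℝ} {q : ℝ → ℝ} {ε : ℝ}

/-- The diagonal block of `M₁` belonging to one edge. -/
def valueBlock (ℓ : ℝ) (q : ℝ → ℝ) (k : ℂ) : Matrix (Fin 2) (Fin 2) ℂ :=
  !![1, 0; cosSol q k ℓ, sinSol q k ℓ]

/-- The diagonal block of `M₂` belonging to one edge. -/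
def derivBlock (ℓ : ℝ) (q : ℝ → ℝ) (k : ℂ) : Matrix (Fin 2) (Fin 2) ℂ :=
  !![0, 1; -derivWithin (cosSol q k) (Icc 0 ℓ) ℓ, -derivWithin (sinSol q k) (Icc 0 ℓ) ℓ]

/-- The Neumann-to-Dirichlet matrix of one edge, which maps the outgoing derivatives of a solution
at the two end points to its values there. It is junk where `c'(ℓ, k) = 0`. -/
def neumannToDirichlet (ℓ : ℝ) (q : ℝ → ℝ) (k : ℂ) : Matrix (Fin 2) (Fin 2) ℂ :=
  (derivWithin (cosSol q k) (Icc 0 ℓ) ℓ)⁻¹ •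
    !![-derivWithin (sinSol q k) (Icc 0 ℓ) ℓ, -1; -1, -cosSol q k ℓ]

lemma det_derivBlock (ℓ : ℝ) (q : ℝ → ℝ) (k : ℂ) :
    (derivBlock ℓ q k).det = derivWithin (cosSol q k) (Icc 0 ℓ) ℓ := by
  simp [derivBlock, Matrix.det_fin_two_of]

lemma neumannToDirichlet_mul_derivBlock (hℓ : 0 < ℓ) (hq : IntervalIntegrable q volume 0 ℓ)
    {k : ℂ} (hk : derivWithin (cosSol q k) (Icc 0 ℓ) ℓ ≠ 0) :
    neumannToDirichlet ℓ q k * derivBlock ℓ q k = valueBlock ℓ q k := by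
  have hwronskian := wronskian_eq_one hℓ hq k
  rw [neumannToDirichlet, Matrix.smul_mul, inv_smul_eq_iff₀ hk, derivBlock, valueBlock,
    Matrix.mul_fin_two]
  ext a b
  fin_cases a <;> fin_cases b
  · simp
  · simp
  · simp [mul_comm]
  · change -1 * 1 + -cosSol q k ℓ * -derivWithin (sinSol q k) (Icc 0 ℓ) ℓ =
      derivWithin (cosSol q k) (Icc 0 ℓ) ℓ * sinSol q k ℓ
    linear_combination hwronskian

lemma differentiable_valueBlock (hℓ : 0 ≤ ℓ) (hq : IntervalIntegrable q volume 0 ℓ)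
    (a b : Fin 2) : Differentiable ℂ fun k => valueBlock ℓ q k a b := by
  fin_cases a <;> fin_cases b
  · exact differentiable_const 1
  · exact differentiable_const 0
  · exact (entireFamily_cosSol hq).differentiable ℓ (right_mem_Icc.2 hℓ)
  · exact (entireFamily_sinSol hq).differentiable ℓ (right_mem_Icc.2 hℓ)

lemma differentiable_derivBlock (hℓ : 0 < ℓ) (hq : IntervalIntegrable q volume 0 ℓ)
    (a b : Fin 2) : Differentiable ℂ fun k => derivBlock ℓ q k a b := by
  fin_cases a <;> fin_cases b
  · exact differentiable_const 0
  · exact differentiable_const 1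
  · exact (differentiable_derivWithin_cosSol hℓ hq).neg
  · exact (differentiable_derivWithin_sinSol hℓ hq).neg

lemma isLittleO_exp_mul_sin (hℓ : 0 < ℓ) (hε : 0 < ε) :
    (fun k : ℂ => Real.exp (|k.im| * ℓ)) =o[cobounded ℂ ⊓ 𝓟 (admissible ℓ ε)]
      fun k => -k * Complex.sin (k * ℓ) := by
  have hone : (fun _ : ℂ => (1 : ℂ)) =o[cobounded ℂ ⊓ 𝓟 (admissible ℓ ε)] fun k => -k :=
    (isLittleO_const_id_cobounded (1 : ℂ)).neg_right.mono inf_le_left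
  refine (isBigO_exp_sin hℓ hε).trans_isLittleO ?_
  simpa only [one_mul] using hone.mul_isBigO (isBigO_refl (fun k : ℂ => Complex.sin (k * ℓ)) _)

lemma isEquivalent_derivWithin_cosSol (hℓ : 0 < ℓ) (hq : IntervalIntegrable q volume 0 ℓ)
    (hε : 0 < ε) :
    (fun k => derivWithin (cosSol q k) (Icc 0 ℓ) ℓ) ~[cobounded ℂ ⊓ 𝓟 (admissible ℓ ε)]
      fun k => -k * Complex.sin (k * ℓ) :=
  ((isBigO_derivWithin_cosSol_sub hℓ hq).mono inf_le_left).trans_isLittleO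
    (isLittleO_exp_mul_sin hℓ hε)

lemma isLittleO_exp_derivWithin_cosSol (hℓ : 0 < ℓ) (hq : IntervalIntegrable q volume 0 ℓ)
    (hε : 0 < ε) :
    (fun k : ℂ => Real.exp (|k.im| * ℓ)) =o[cobounded ℂ ⊓ 𝓟 (admissible ℓ ε)]
      fun k => derivWithin (cosSol q k) (Icc 0 ℓ) ℓ :=
  (isLittleO_exp_mul_sin hℓ hε).trans_isBigO (isEquivalent_derivWithin_cosSol hℓ hq hε).symm.isBigO

lemma eventually_ne_zero_of_isLittleO_exp {l : Filter ℂ} {f : ℂ → ℂ} {φ : ℂ → ℝ}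
    (h : (fun k => Real.exp (φ k)) =o[l] f) : ∀ᶠ k in l, f k ≠ 0 :=
  (h.isBigO.eq_zero_imp).mono fun _ hk h0 => (Real.exp_pos _).ne' (hk h0)

lemma tendsto_derivWithin_cosSol_div (hℓ : 0 < ℓ) (hq : IntervalIntegrable q volume 0 ℓ)
    (hε : 0 < ε) :
    Tendsto (fun k => derivWithin (cosSol q k) (Icc 0 ℓ) ℓ / (-k * Complex.sin (k * ℓ)))
      (cobounded ℂ ⊓ 𝓟 (admissible ℓ ε)) (𝓝 1) :=
  (isEquivalent_iff_tendsto_one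
    (eventually_ne_zero_of_isLittleO_exp (isLittleO_exp_mul_sin hℓ hε))).1
      (isEquivalent_derivWithin_cosSol hℓ hq hε)

lemma tendsto_neumannToDirichlet (hℓ : 0 < ℓ) (hq : IntervalIntegrable q volume 0 ℓ)
    (hε : 0 < ε) :
    Tendsto (neumannToDirichlet ℓ q) (cobounded ℂ ⊓ 𝓟 (admissible ℓ ε)) (𝓝 0) := by
  have hentry : ∀ f : ℂ → ℂ, f =O[cobounded ℂ] (fun k => Real.exp (|k.im| * ℓ)) →
      Tendsto (fun k => (derivWithin (cosSol q k) (Icc 0 ℓ) ℓ)⁻¹ * f k)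
        (cobounded ℂ ⊓ 𝓟 (admissible ℓ ε)) (𝓝 0) := fun f hf => by
    simpa only [div_eq_inv_mul] using ((hf.mono inf_le_left).trans_isLittleO
      (isLittleO_exp_derivWithin_cosSol hℓ hq hε)).tendsto_div_nhds_zero
  have hneg_one : (fun _ : ℂ => (-1 : ℂ)) =O[cobounded ℂ] fun k => Real.exp (|k.im| * ℓ) :=
    IsBigO.of_norm_le fun k => by
      rw [norm_neg, norm_one]
      exact Real.one_le_exp (mul_nonneg (abs_nonneg k.im) hℓ.le)
  refine tendsto_pi_nhds.2 fun a => tendsto_pi_nhds.2 fun b => ?_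
  fin_cases a <;> fin_cases b
  · exact hentry _ (isBigO_derivWithin_sinSol hℓ hq).neg_left
  · exact hentry _ hneg_one
  · exact hentry _ hneg_one
  · exact hentry _ (isBigO_cosSol hℓ.le hq).neg_left

end SingleEdge

section Secular

open Filter Topology Bornology

variable {d : ℕ} {ℓ : Fin d → ℝ} {q : Fin d → ℝ → ℝ}

/-- The secular function of an arbitrary coupling matrix `H`, which need not come from a unitary
matrix. -/
def secularDet (ℓ : Fin d → ℝ) (q : Fin d → ℝ → ℝ) (H : Matrix (Fin d × Fin 2) (Fin d × Fin 2) ℂ)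
    (k : ℂ) : ℂ :=
  (H * M₁ ℓ q k + M₂ ℓ q k).det

lemma M₁_eq_edgeDiagonal (ℓ : Fin d → ℝ) (q : Fin d → ℝ → ℝ) (k : ℂ) :
    M₁ ℓ q k = edgeDiagonal fun i => valueBlock (ℓ i) (q i) k := by
  ext ⟨i, a⟩ ⟨j, b⟩
  simp [M₁, edgeDiagonal, valueBlock, Matrix.blockDiagonal_apply]

lemma M₂_eq_edgeDiagonal (ℓ : Fin d → ℝ) (q : Fin d → ℝ → ℝ) (k : ℂ) :
    M₂ ℓ q k = edgeDiagonal fun i => derivBlock (ℓ i) (q i) k := by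
  ext ⟨i, a⟩ ⟨j, b⟩
  simp [M₂, edgeDiagonal, derivBlock, Matrix.blockDiagonal_apply]

lemma differentiable_secularDet (hℓ : ∀ i, 0 < ℓ i)
    (hq : ∀ i, IntervalIntegrable (q i) volume 0 (ℓ i))
    (H : Matrix (Fin d × Fin 2) (Fin d × Fin 2) ℂ) : Differentiable ℂ (secularDet ℓ q H) := by
  have hM₁ : ∀ p r, Differentiable ℂ fun k => M₁ ℓ q k p r := by
    simp only [M₁_eq_edgeDiagonal]
    exact differentiable_edgeDiagonal fun i => differentiable_valueBlock (hℓ i).le (hq i)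
  have hM₂ : ∀ p r, Differentiable ℂ fun k => M₂ ℓ q k p r := by
    simp only [M₂_eq_edgeDiagonal]
    exact differentiable_edgeDiagonal fun i => differentiable_derivBlock (hℓ i) (hq i)
  refine differentiable_det fun p r => ?_
  simp only [Matrix.add_apply, Matrix.mul_apply]
  fun_prop

lemma secularDet_eq_mul (hℓ : ∀ i, 0 < ℓ i) (hq : ∀ i, IntervalIntegrable (q i) volume 0 (ℓ i))
    (H : Matrix (Fin d × Fin 2) (Fin d × Fin 2) ℂ) {k : ℂ}
    (hk : ∀ i, derivWithin (cosSol (q i) k) (Icc 0 (ℓ i)) (ℓ i) ≠ 0) :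
    secularDet ℓ q H k = (H * edgeDiagonal (fun i => neumannToDirichlet (ℓ i) (q i) k) + 1).det *
      ∏ i, derivWithin (cosSol (q i) k) (Icc 0 (ℓ i)) (ℓ i) := by
  have hM₁ : edgeDiagonal (fun i => neumannToDirichlet (ℓ i) (q i) k) * M₂ ℓ q k = M₁ ℓ q k := by
    simp only [M₁_eq_edgeDiagonal, M₂_eq_edgeDiagonal, edgeDiagonal_mul,
      fun i => neumannToDirichlet_mul_derivBlock (hℓ i) (hq i) (hk i)]
  have hdet : (M₂ ℓ q k).det = ∏ i, derivWithin (cosSol (q i) k) (Icc 0 (ℓ i)) (ℓ i) := by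
    simp only [M₂_eq_edgeDiagonal, det_edgeDiagonal, det_derivBlock]
  rw [secularDet, ← hdet, ← Matrix.det_mul, add_mul, one_mul, mul_assoc, hM₁]

lemma tendsto_secularDet_div_sineProduct (hℓ : ∀ i, 0 < ℓ i)
    (hq : ∀ i, IntervalIntegrable (q i) volume 0 (ℓ i))
    (H : Matrix (Fin d × Fin 2) (Fin d × Fin 2) ℂ) {ε : ℝ} (hε : 0 < ε) :
    Tendsto (fun k => secularDet ℓ q H k / sineProduct ℓ k)
      (cobounded ℂ ⊓ 𝓟 (⋂ i, admissible (ℓ i) ε)) (𝓝 1) := by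
  have hle : ∀ i, cobounded ℂ ⊓ 𝓟 (⋂ i, admissible (ℓ i) ε) ≤
      cobounded ℂ ⊓ 𝓟 (admissible (ℓ i) ε) := fun i =>
    inf_le_inf_left _ (principal_mono.2 (iInter_subset _ i))
  have hdet : Tendsto
      (fun k => (H * edgeDiagonal (fun i => neumannToDirichlet (ℓ i) (q i) k) + 1).det)
      (cobounded ℂ ⊓ 𝓟 (⋂ i, admissible (ℓ i) ε)) (𝓝 1) := by
    have hcont : Continuous fun A : Fin d → Matrix (Fin 2) (Fin 2) ℂ =>
        (H * edgeDiagonal A + 1).det :=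
      ((continuous_const.matrix_mul continuous_edgeDiagonal).add continuous_const).matrix_det
    have hzero : Tendsto (fun k i => neumannToDirichlet (ℓ i) (q i) k)
        (cobounded ℂ ⊓ 𝓟 (⋂ i, admissible (ℓ i) ε)) (𝓝 0) :=
      tendsto_pi_nhds.2 fun i => (tendsto_neumannToDirichlet (hℓ i) (hq i) hε).mono_left (hle i)
    simpa only [Function.comp_def, edgeDiagonal_zero, mul_zero, zero_add, Matrix.det_one]
      using (hcont.tendsto 0).comp hzero
  have hprod := tendsto_finsetProd Finset.univ fun i _ =>
    (tendsto_derivWithin_cosSol_div (hℓ i) (hq i) hε).mono_left (hle i)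
  have hne : ∀ᶠ k in cobounded ℂ ⊓ 𝓟 (⋂ i, admissible (ℓ i) ε),
      ∀ i, derivWithin (cosSol (q i) k) (Icc 0 (ℓ i)) (ℓ i) ≠ 0 := eventually_all.2 fun i =>
    (eventually_ne_zero_of_isLittleO_exp
      (isLittleO_exp_derivWithin_cosSol (hℓ i) (hq i) hε)).filter_mono (hle i)
  have hmul := hdet.mul hprod
  rw [Finset.prod_const_one, mul_one] at hmul
  refine hmul.congr' ?_
  filter_upwards [hne] with k hk
  rw [secularDet_eq_mul hℓ hq H hk, Finset.prod_div_distrib, sineProduct, mul_div_assoc]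

lemma exists_norm_secularDet_sub_lt (hℓ : ∀ i, 0 < ℓ i)
    (hq : ∀ i, IntervalIntegrable (q i) volume 0 (ℓ i))
    (H : Matrix (Fin d × Fin 2) (Fin d × Fin 2) ℂ) {ε : ℝ} (hε : 0 < ε) :
    ∃ K : ℝ, ∀ k ∈ ⋂ i, admissible (ℓ i) ε, K ≤ ‖k‖ →
      ‖secularDet ℓ q H k - sineProduct ℓ k‖ < ‖sineProduct ℓ k‖ := by
  have hball := (tendsto_secularDet_div_sineProduct hℓ hq H hε).eventually
    (Metric.ball_mem_nhds 1 one_pos)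
  rw [eventually_inf_principal, hasBasis_cobounded_norm.eventually_iff] at hball
  obtain ⟨K, -, hK⟩ := hball
  refine ⟨K, fun k hk hkK => ?_⟩
  have hdist := hK hkK hk
  rw [dist_eq_norm] at hdist
  have hne : sineProduct ℓ k ≠ 0 := fun h0 => by
    rw [h0, div_zero, zero_sub, norm_neg, norm_one] at hdist
    exact hdist.false
  rwa [div_sub_one hne, norm_div, div_lt_one (norm_pos_iff.2 hne)] at hdist

lemma differentiable_sineProduct (ℓ : Fin d → ℝ) : Differentiable ℂ (sineProduct ℓ) := by
  unfold sineProduct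
  fun_prop

end Secular

end QGraph

end

theorem mainTheorem2_general {d : ℕ} (ℓ : Fin d → ℝ) (hℓ : ∀ i, 0 < ℓ i)
    (q : Fin d → ℝ → ℝ) (hq : ∀ i, IntervalIntegrable (q i) volume 0 (ℓ i))
    (H : Matrix (Fin d × Fin 2) (Fin d × Fin 2) ℂ) :
    Differentiable ℂ (QGraph.secularDet ℓ q H) ∧
    ∀ ε > (0 : ℝ), ∃ K > (0 : ℝ), ∀ N > K,
      N ∉ ⋃ (i : Fin d) (n : ℕ),
        Set.Ioo (n * Real.pi / ℓ i - ε / ℓ i) (n * Real.pi / ℓ i + ε / ℓ i) →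
      (QGraph.zerosIn (QGraph.secularDet ℓ q H) (QGraph.insideSquare N)).Finite ∧
      (QGraph.zerosIn (QGraph.sineProduct ℓ) (QGraph.insideSquare N)).Finite ∧
      QGraph.zeroCount (QGraph.secularDet ℓ q H) (QGraph.insideSquare N) =
        QGraph.zeroCount (QGraph.sineProduct ℓ) (QGraph.insideSquare N) := by
  have hdiff := QGraph.differentiable_secularDet hℓ hq H
  refine ⟨hdiff, fun ε hε => ?_⟩
  obtain ⟨K, hK⟩ := QGraph.exists_norm_secularDet_sub_lt hℓ hq H hε
  refine ⟨max K 1, by positivity, fun N hN hNadm => ?_⟩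
  refine QGraph.zeroCount_eq_of_norm_sub_lt (zero_lt_one.trans ((le_max_right K 1).trans_lt hN))
    (fun z _ => hdiff.analyticAt z)
    (fun z _ => (QGraph.differentiable_sineProduct ℓ).analyticAt z) fun k hk => hK k ?_ ?_
  · rw [← show max |k.re| |k.im| = N from hk] at hNadm
    exact mem_iInter.2 fun i n hn => hNadm (mem_iUnion₂.2 ⟨i, n, hn⟩)
  · calc K ≤ N := (le_max_left K 1).trans hN.le
      _ = max |k.re| |k.im| := hk.symm
      _ ≤ ‖k‖ := max_le (Complex.abs_re_le_norm k) (Complex.abs_im_le_norm k)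

theorem mainTheorem2 {d : ℕ} (ℓ : Fin d → ℝ) (hℓ : ∀ i, 0 < ℓ i)
    (q : Fin d → ℝ → ℝ) (hq : ∀ i, QGraph.MemW11 (ℓ i) (q i))
    (U : Matrix (Fin d × Fin 2) (Fin d × Fin 2) ℂ)
    (hU : U ∈ Matrix.unitaryGroup (Fin d × Fin 2) ℂ)
    (hU' : (-1 : ℂ) ∉ spectrum ℂ U) :
    Differentiable ℂ (QGraph.secular ℓ q U) ∧
    ∀ ε > (0 : ℝ), ∃ K > (0 : ℝ), ∀ N > K,
      N ∉ ⋃ (i : Fin d) (n : ℕ),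
        Set.Ioo (n * Real.pi / ℓ i - ε / ℓ i) (n * Real.pi / ℓ i + ε / ℓ i) →
      (QGraph.zerosIn (QGraph.secular ℓ q U) (QGraph.insideSquare N)).Finite ∧
      (QGraph.zerosIn (QGraph.sineProduct ℓ) (QGraph.insideSquare N)).Finite ∧
      QGraph.zeroCount (QGraph.secular ℓ q U) (QGraph.insideSquare N) =
        QGraph.zeroCount (QGraph.sineProduct ℓ) (QGraph.insideSquare N) :=
  mainTheorem2_general ℓ hℓ q (fun i => (hq i).intervalIntegrable (hℓ i).le) (QGraph.couplingH U)
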